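/- Let $X$ be a complex Banach space with dual $X'$, and let $T(\cdot)$ be an exponentially stable $C_0$-semigroup on $X$ with generator $A$ (exponentially stable: $\|T(t)\|\le Me^{-\omega t}$ for some $M$ and some $\omega>0$). Let $\mathcal H^\infty_-$ be the algebra of bounded holomorphic functions on $\mathbb C_-=\{z:\operatorname{Re}z<0\}$, identified with their boundary functions on $i\mathbb R$. For $g\in\mathcal H^\infty_-$ let $M_g$ be the Toeplitz operator on $L^2(0,\infty)$, $M_gh=\mathfrak L^{-1}\Pi(g\cdot\mathfrak Lh)$, where $\mathfrak L$ is the Laplace transform and $\Pi$ is the orthogonal projection of $L^2(i\mathbb R)$ onto the Hardy space $\mathcal H^2=\mathfrak L(L^2(0,\infty))$. Let $g(A)$ denote the unique linear operator $D(A)\to X$, bounded for the graph norm on $D(A)$, such that for all $y\in X'$ and $x\in D(A)$ $$\big(M_g\langle y,T(\cdot)x\rangle\big)(t)=\langle y,g(A)T(t)x\rangle\quad\text{for almost every }t>0,$$ and let $g_\Lambda(A)$ be its Lambda extension $$g_\Lambda(A)x=\lim_{\lambda\to\infty}\lambda\,g(A)(\lambda I-A)^{-1}x,\qquad D(g_\Lambda(A))=\{x\in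 X:\text{the limit exists}\}.$$ Let $f\in\mathcal H^\infty_-$ and let $\epsilon>0$ be such that the rescaled semigroup $\tilde T(t)=e^{\epsilon t}T(t)$ is exponentially stable. Put $g(z)=f(z-\epsilon)$ for $z\in\mathbb C_-$. Then $\tilde T(\cdot)$ has generator $A+\epsilon I$, the operators $f(A)$ (formed with $T$) and $g(A+\epsilon I)$ (formed with $\tilde T$) exist and are unique, and $$g_\Lambda(A+\epsilon I)=f_\Lambda(A),$$ that is, both operators have the same domain and agree on it. -/

import Mathlib

open MeasureTheory Filter Set
open scoped Topology NNReal ENNReal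

noncomputable section

namespace HInfCalculus

/-! ### Bounded holomorphic functions on the left half-plane -/

/-- The algebra of bounded holomorphic functions on the open left half-plane `Re z < 0`.
Only the values on the left half-plane matter. -/
structure HInfMinus where
  toFun : ℂ → ℂ
  holo : DifferentiableOn ℂ toFun {z | z.re < 0}
  bdd : ∃ M : ℝ, ∀ z : ℂ, z.re < 0 → ‖toFun z‖ ≤ M

instance : CoeFun HInfMinus (fun _ => ℂ → ℂ) := ⟨HInfMinus.toFun⟩

/-- The translate `z ↦ f (z - ε)`, `ε ≥ 0`. -/
def HInfMinus.shift (f : HInfMinus) (ε : ℝ) (hε : 0 ≤ ε) : HInfMinus where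
  toFun z := f (z - ε)
  holo := by
    refine f.holo.comp (by fun_prop) ?_
    intro z hz
    simp only [mem_ofPred_eq, Complex.sub_re, Complex.ofReal_re] at hz ⊢
    linarith
  bdd := by
    obtain ⟨M, hM⟩ := f.bdd
    refine ⟨M, fun z hz => hM _ ?_⟩
    simp only [Complex.sub_re, Complex.ofReal_re]
    linarith

/-- `l` is the limit of `g` at the boundary point `i w`, approached horizontally from the left. -/
def HasBoundaryLimit (g : ℂ → ℂ) (w : ℝ) (l : ℂ) : Prop :=
  Tendsto (fun r : ℝ => g (-(r : ℂ) + w * Complex.I)) (𝓝[>] 0) (𝓝 l)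

open Classical in
/-- The boundary function of `g` on the imaginary axis: the limit from the left at `i w`, where it
exists (for bounded holomorphic `g` this is at almost every `w`). -/
def boundaryValue (g : ℂ → ℂ) (w : ℝ) : ℂ :=
  if h : ∃ l, HasBoundaryLimit g w l then h.choose else 0

lemma HasBoundaryLimit.boundaryValue_eq {g : ℂ → ℂ} {w : ℝ} {l : ℂ}
    (h : HasBoundaryLimit g w l) : boundaryValue g w = l := by
  have h' : ∃ l, HasBoundaryLimit g w l := ⟨l, h⟩
  rw [boundaryValue, dif_pos h']
  exact tendsto_nhds_unique h'.choose_spec h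

lemma HInfMinus.continuousOn_line (g : HInfMinus) (w : ℝ) :
    ContinuousOn (fun r : ℝ => g (-(r : ℂ) + w * Complex.I)) (Ioi 0) := by
  refine g.holo.continuousOn.comp (by fun_prop) ?_
  intro r hr
  simpa using hr

lemma HInfMinus.continuous_vertical (g : HInfMinus) {r : ℝ} (hr : 0 < r) :
    Continuous (fun w : ℝ => g (-(r : ℂ) + w * Complex.I)) := by
  refine g.holo.continuousOn.comp_continuous (by fun_prop) ?_
  intro w
  simpa using hr

/-- The positive rational numbers. -/
abbrev PosRat : Type := {q : ℚ // 0 < q}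

/-- For bounded holomorphic functions it is enough to test the limit along rational points. -/
lemma HInfMinus.hasBoundaryLimit_iff (g : HInfMinus) (w : ℝ) (l : ℂ) :
    HasBoundaryLimit g w l ↔
      Tendsto (fun q : PosRat => g (-(((q : ℚ) : ℝ) : ℂ) + w * Complex.I))
        (comap (fun q : PosRat => ((q : ℚ) : ℝ)) (𝓝[>] 0)) (𝓝 l) := by
  constructor
  · intro h
    exact h.comp tendsto_comap
  · intro h
    rw [HasBoundaryLimit, (closed_nhds_basis l).tendsto_right_iff]
    rintro V ⟨hV, hVc⟩
    have h1 := h hV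
    rw [mem_map, mem_comap] at h1
    obtain ⟨U, hU, hUV⟩ := h1
    obtain ⟨δ, hδ, hδU⟩ := (mem_nhdsGT_iff_exists_Ioo_subset).1 hU
    filter_upwards [Ioo_mem_nhdsGT hδ] with r hr
    by_contra hcon
    have hc := (g.continuousOn_line w).mono (Ioo_subset_Ioi_self : Ioo (0 : ℝ) δ ⊆ Ioi 0)
    have hopen : IsOpen (Ioo (0 : ℝ) δ ∩
        (fun r : ℝ => g (-(r : ℂ) + w * Complex.I)) ⁻¹' Vᶜ) :=
      hc.isOpen_inter_preimage isOpen_Ioo hVc.isOpen_compl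
    obtain ⟨q, hq⟩ := Rat.denseRange_cast.exists_mem_open hopen ⟨r, hr, hcon⟩
    have hq0 : 0 < q := by exact_mod_cast hq.1.1
    exact hq.2 (@hUV ⟨q, hq0⟩ (hδU hq.1))

lemma HInfMinus.measurable_boundaryValue (g : HInfMinus) : Measurable (boundaryValue g) := by
  set E : Set ℝ := {w | ∃ l, HasBoundaryLimit g w l} with hE
  have hEm : MeasurableSet E := by
    simp only [hE, g.hasBoundaryLimit_iff]
    refine MeasureTheory.measurableSet_exists_tendsto (fun q => ?_)
    refine (g.continuous_vertical ?_).measurable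
    exact_mod_cast q.2
  refine measurable_of_tendsto_metrizable
    (f := fun n : ℕ => E.indicator (fun w => g (-((1 / ((n : ℝ) + 1) : ℝ) : ℂ) + w * Complex.I)))
    (fun n => ((g.continuous_vertical (by positivity)).measurable).indicator hEm) ?_
  rw [tendsto_pi_nhds]
  intro w
  by_cases hw : w ∈ E
  · simp only [indicator_of_mem hw]
    obtain ⟨l, hl⟩ := hw
    rw [hl.boundaryValue_eq]
    refine hl.comp (tendsto_nhdsWithin_iff.2 ⟨tendsto_one_div_add_atTop_nhds_zero_nat, ?_⟩)
    exact Eventually.of_forall fun n => by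
      simp only [mem_Ioi]
      positivity
  · simp only [indicator_of_notMem hw]
    rw [boundaryValue, dif_neg (show ¬ ∃ l, HasBoundaryLimit g w l from hw)]
    exact tendsto_const_nhds

lemma HInfMinus.exists_boundaryValue_bound (g : HInfMinus) :
    ∃ M : ℝ, ∀ w, ‖boundaryValue g w‖ ≤ M := by
  obtain ⟨M, hM⟩ := g.bdd
  refine ⟨max M 0, fun w => ?_⟩
  by_cases h : ∃ l, HasBoundaryLimit g w l
  · obtain ⟨l, hl⟩ := h
    rw [hl.boundaryValue_eq]
    refine le_trans ?_ (le_max_left _ _)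
    refine le_of_tendsto hl.norm ?_
    filter_upwards [self_mem_nhdsWithin] with r hr
    exact hM _ (by simpa using hr)
  · rw [boundaryValue, dif_neg h]
    simp

/-- The boundary function of `g` as an element of `L^∞` of the imaginary axis. The axis is
parametrized by `ξ ↦ 2 π i ξ`, in accordance with the normalization of the Fourier transform. -/
def HInfMinus.boundary (g : HInfMinus) : Lp ℂ ∞ (volume : Measure ℝ) :=
  MemLp.toLp (fun ξ : ℝ => boundaryValue g (2 * Real.pi * ξ)) <| by
    obtain ⟨M, hM⟩ := g.exists_boundaryValue_bound
    exact memLp_top_of_bound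
      ((g.measurable_boundaryValue.comp (by fun_prop)).aestronglyMeasurable) M
      (Eventually.of_forall fun ξ => hM _)

/-! ### Laplace transform, Hardy space and Toeplitz operators -/

/-- The space `L²(0,∞)`. -/
abbrev L2Pos : Type := Lp ℂ 2 ((volume : Measure ℝ).restrict (Ioi 0))

/-- The space `L²(iℝ)`, with the imaginary axis parametrized by `ξ ↦ 2 π i ξ`. -/
abbrev L2Line : Type := Lp ℂ 2 (volume : Measure ℝ)

lemma memLp_indicator_L2Pos (f : L2Pos) :
    MemLp ((Ioi (0 : ℝ)).indicator f) 2 (volume : Measure ℝ) :=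
  (memLp_indicator_iff_restrict measurableSet_Ioi).2 (Lp.memLp f)

/-- Extension by zero `L²(0,∞) → L²(ℝ)`. -/
def extendZero : L2Pos →ₗᵢ[ℂ] Lp ℂ 2 (volume : Measure ℝ) where
  toFun f := (memLp_indicator_L2Pos f).toLp
  map_add' f g := by
    rw [← MemLp.toLp_add, MemLp.toLp_eq_toLp_iff, ← indicator_add']
    exact (ae_eq_restrict_iff_indicator_ae_eq measurableSet_Ioi).1 (Lp.coeFn_add f g)
  map_smul' c f := by
    rw [RingHom.id_apply, ← MemLp.toLp_const_smul, MemLp.toLp_eq_toLp_iff]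
    refine ((ae_eq_restrict_iff_indicator_ae_eq measurableSet_Ioi).1 (Lp.coeFn_smul c f)).trans ?_
    exact Eventually.of_forall fun x => by
      by_cases hx : x ∈ Ioi (0 : ℝ) <;> simp [hx]
  norm_map' f := by
    change ‖(memLp_indicator_L2Pos f).toLp‖ = ‖f‖
    rw [Lp.norm_toLp, Lp.norm_def, eLpNorm_indicator_eq_eLpNorm_restrict measurableSet_Ioi]

/-- The Laplace transform of `f ∈ L²(0,∞)`, identified with its boundary function
`𝔏f(2πiξ) = ∫₀^∞ e^{-2πiξt} f(t) dt` (Plancherel transform) on the imaginary axis. -/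
def laplace : L2Pos →ₗᵢ[ℂ] L2Line :=
  (Lp.fourierTransformₗᵢ ℝ ℂ).toLinearIsometry.comp extendZero

/-- The Hardy space `H²` of the right half-plane, i.e. the Laplace transforms of `L²(0,∞)`,
as a subspace of `L²(iℝ)`. -/
abbrev hardy : Submodule ℂ L2Line := LinearMap.range laplace.toLinearMap

instance : CompleteSpace hardy :=
  laplace.equivRange.toIsometryEquiv.completeSpace_iff.1 inferInstance

/-- The inverse Laplace transform `H² → L²(0,∞)`. -/
def laplaceInv : hardy ≃ₗᵢ[ℂ] L2Pos := laplace.equivRange.symm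

/-- The Toeplitz operator `M_g f = 𝔏⁻¹ Π (g · 𝔏 f)` on `L²(0,∞)`, where `Π` is the orthogonal
projection of `L²(iℝ)` onto `H²`. -/
def toeplitz (g : HInfMinus) (f : L2Pos) : L2Pos :=
  laplaceInv (hardy.orthogonalProjectionOnto ((g.boundary • laplace f : L2Line)))

/-! ### Operators given as pointwise limits -/

section LimitOperator

variable {D X : Type*} [AddCommGroup D] [Module ℂ D] [NormedAddCommGroup X] [NormedSpace ℂ X]

/-- The operator `x ↦ lim_l F i x`, with domain the set of all `x` for which the limit exists. -/
def limitOp {ι : Type*} (l : Filter ι) [l.NeBot] (F : ι → D →ₗ[ℂ] X) : D →ₗ.[ℂ] X where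
  domain :=
    { carrier := {x | ∃ z, Tendsto (fun i => F i x) l (𝓝 z)}
      add_mem' := by
        rintro x y ⟨z, hz⟩ ⟨w, hw⟩
        exact ⟨z + w, by simpa using hz.add hw⟩
      zero_mem' := ⟨0, by simp⟩
      smul_mem' := by
        rintro c x ⟨z, hz⟩
        exact ⟨c • z, by simpa using hz.const_smul c⟩ }
  toFun :=
    { toFun := fun x => x.2.choose
      map_add' := fun x y => by
        refine tendsto_nhds_unique (x + y).2.choose_spec ?_
        simpa using x.2.choose_spec.add y.2.choose_spec
      map_smul' := fun c x => by
        refine tendsto_nhds_unique (c • x).2.choose_spec ?_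
        simpa using x.2.choose_spec.const_smul c }

lemma limitOp_spec {ι : Type*} (l : Filter ι) [l.NeBot] (F : ι → D →ₗ[ℂ] X)
    (x : (limitOp l F).domain) : Tendsto (fun i => F i (x : D)) l (𝓝 (limitOp l F x)) :=
  x.2.choose_spec

end LimitOperator

/-! ### Semigroups -/

/-- A `C₀`-semigroup of bounded operators on `X`. -/
structure C0Semigroup (X : Type*) [NormedAddCommGroup X] [NormedSpace ℂ X] where
  toFun : ℝ≥0 → X →L[ℂ] X
  map_zero' : toFun 0 = 1
  map_add' : ∀ s t, toFun (s + t) = (toFun s).comp (toFun t)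
  continuous' : ∀ x, Continuous fun t => toFun t x

namespace C0Semigroup

variable {X : Type*} [NormedAddCommGroup X] [NormedSpace ℂ X]

instance : CoeFun (C0Semigroup X) (fun _ => ℝ≥0 → X →L[ℂ] X) := ⟨C0Semigroup.toFun⟩

/-- Exponential stability: `‖T(t)‖ ≤ M e^{-ω t}` for some `ω > 0`. -/
def ExpStable (T : C0Semigroup X) : Prop :=
  ∃ M ω : ℝ, 0 < ω ∧ ∀ t : ℝ≥0, ‖T t‖ ≤ M * Real.exp (-ω * t)

/-- The rescaled semigroup `e^{εt} T(t)`. -/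
def rescale (T : C0Semigroup X) (ε : ℝ) : C0Semigroup X where
  toFun t := ((Real.exp (ε * t) : ℝ) : ℂ) • T t
  map_zero' := by simp [T.map_zero']
  map_add' s t := by
    rw [T.map_add']
    ext x
    simp only [NNReal.coe_add, mul_add, Real.exp_add, Complex.ofReal_mul,
      _root_.smul_apply, ContinuousLinearMap.comp_apply, map_smul, smul_smul]
    rw [mul_comm]
  continuous' x := by
    have h := T.continuous' x
    simp only [_root_.smul_apply]
    exact (by fun_prop : Continuous fun t : ℝ≥0 => ((Real.exp (ε * t) : ℝ) : ℂ)).smul h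

/-- The infinitesimal generator `A x = lim_{t → 0+} (T(t) x - x) / t`, with its natural domain. -/
def generator (T : C0Semigroup X) : X →ₗ.[ℂ] X :=
  limitOp (𝓝[>] (0 : ℝ≥0)) fun t =>
    (((t : ℝ) : ℂ)⁻¹) • ((T t : X →ₗ[ℂ] X) - LinearMap.id)

lemma map_mem_domain (T : C0Semigroup X) (t : ℝ≥0) {x : X} (hx : x ∈ T.generator.domain) :
    T t x ∈ T.generator.domain := by
  obtain ⟨z, hz⟩ := hx
  refine ⟨T t z, (((T t).continuous.tendsto z).comp hz).congr fun s => ?_⟩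
  have h : T t (T s x) = T s (T t x) := by
    rw [← ContinuousLinearMap.comp_apply, ← T.map_add', add_comm, T.map_add',
      ContinuousLinearMap.comp_apply]
  simp [h]

open Classical in
/-- The resolvent `R(μ, A) = (μ - A)⁻¹ : X → D(A)` of the generator, for `μ` in the resolvent set
(and `0` for other `μ`). As `A` is closed, `μ` is in the resolvent set iff `μ - A` is bijective. -/
def resolvent (T : C0Semigroup X) (μ : ℂ) : X →ₗ[ℂ] T.generator.domain :=
  if h : Function.Bijective (μ • T.generator.domain.subtype - T.generator.toFun) then
    (LinearEquiv.ofBijective (μ • T.generator.domain.subtype - T.generator.toFun) h).symm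
  else 0

/-- The Lambda extension of `C : D(A) → X`: `C_Λ x = lim_{μ → ∞} μ C R(μ, A) x` (`μ` real), with
domain the set of all `x` for which the limit exists. -/
def lambdaExt (T : C0Semigroup X) (C : T.generator.domain →ₗ[ℂ] X) : X →ₗ.[ℂ] X :=
  limitOp (atTop : Filter ℝ) fun μ => (μ : ℂ) • C.comp (T.resolvent (μ : ℂ))

variable {T : C0Semigroup X}

lemma memLp_orbit (hT : T.ExpStable) (x : X) (y : StrongDual ℂ X) :
    MemLp (fun t : ℝ => y (T t.toNNReal x)) 2 ((volume : Measure ℝ).restrict (Ioi 0)) := by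
  obtain ⟨M, ω, hω, hM⟩ := hT
  have hcont : Continuous (fun t : ℝ => y (T t.toNNReal x)) :=
    y.continuous.comp ((T.continuous' x).comp continuous_real_toNNReal)
  have hexp : MemLp (fun t : ℝ => Real.exp (-ω * t)) 2
      ((volume : Measure ℝ).restrict (Ioi 0)) := by
    rw [memLp_two_iff_integrable_sq (by fun_prop)]
    have h := exp_neg_integrableOn_Ioi 0 (b := 2 * ω) (by positivity)
    refine h.congr_fun (fun t _ => ?_) measurableSet_Ioi
    simp only
    rw [← Real.exp_nat_mul]
    congr 1
    push_cast
    ring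
  refine hexp.of_le_mul (c := ‖y‖ * M * ‖x‖) hcont.aestronglyMeasurable ?_
  filter_upwards [ae_restrict_mem measurableSet_Ioi] with t ht
  have ht' : ((t.toNNReal : ℝ≥0) : ℝ) = t := Real.coe_toNNReal _ (le_of_lt ht)
  have h1 := hM t.toNNReal
  rw [ht'] at h1
  calc ‖y (T t.toNNReal x)‖ ≤ ‖y‖ * (‖T t.toNNReal‖ * ‖x‖) :=
        (y.le_opNorm _).trans (by gcongr; exact (T t.toNNReal).le_opNorm x)
    _ ≤ ‖y‖ * ((M * Real.exp (-ω * t)) * ‖x‖) := by gcongr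
    _ = ‖y‖ * M * ‖x‖ * ‖Real.exp (-ω * t)‖ := by
        rw [Real.norm_eq_abs, abs_of_pos (Real.exp_pos _)]
        ring

/-- The function `t ↦ ⟨y, T(t) x⟩` as an element of `L²(0,∞)`. -/
def orbit (hT : T.ExpStable) (x : X) (y : StrongDual ℂ X) : L2Pos :=
  (memLp_orbit hT x y).toLp

/-- `C` is the operator `g(A)`: it is bounded from `D(A)` with the graph norm to `X`, and
`(M_g ⟨y, T(·) x⟩)(t) = ⟨y, C T(t) x⟩` for all `y ∈ X'`, `x ∈ D(A)` and almost all `t > 0`. -/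
structure IsHInfOp (hT : T.ExpStable) (g : HInfMinus) (C : T.generator.domain →ₗ[ℂ] X) :
    Prop where
  bounded : ∃ c : ℝ, ∀ x : T.generator.domain, ‖C x‖ ≤ c * (‖(x : X)‖ + ‖T.generator x‖)
  toeplitz_eq : ∀ (y : StrongDual ℂ X) (x : T.generator.domain),
    toeplitz g (orbit hT (x : X) y) =ᵐ[(volume : Measure ℝ).restrict (Ioi 0)]
      fun t : ℝ => y (C ⟨T t.toNNReal x, T.map_mem_domain _ x.2⟩)

open Classical in
/-- The operator `g(A) : D(A) → X`, the unique operator with the property `IsHInfOp`. -/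
def hInfOp (hT : T.ExpStable) (g : HInfMinus) : T.generator.domain →ₗ[ℂ] X :=
  if h : ∃ C, IsHInfOp hT g C then h.choose else 0

/-- The weakly admissible calculus: `g_Λ(A)`, the Lambda extension of `g(A)`. -/
def lambdaCalc (hT : T.ExpStable) (g : HInfMinus) : X →ₗ.[ℂ] X :=
  T.lambdaExt (hInfOp hT g)

end C0Semigroup

end HInfCalculus

end

noncomputable section

namespace HInfCalculus

/-! ### Fatou's theorem for bounded holomorphic functions on the left half-plane -/

/-! The heart of the matter is that Toeplitz operators commute with exponential weights:
M_g(e^{εt}F) = e^{εt} M_f F when g(z) = f(z - ε) and e^{εt}F still decays exponentially. Paired with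
a test function K, both sides are integrals of the single function H(z) = K̂(-z - ε) f(z) F̂(z), one
over Re z = -ε and the other over the imaginary axis. The extra decay of F makes F̂ holomorphic
slightly beyond Re z = -ε, so Cauchy's theorem equates the two (`toeplitz_shift_ae_eq`). For orbits
of T this says that f(A) has the property defining g(A + ε), on the same domain, and uniqueness
gives g(A + ε) = f(A). Since R(μ, A + ε) = R(μ - ε, A), the two Lambda limits differ only by the
factor μ/(μ - ε) → 1 (`lambdaExt_rescale`).

For existence, f(z)/(1 - z) has square integrable boundary values and equals ∫ h(s) e^{sz} ds with h
vanishing on s < 0 (`kernel_ae_eq_zero`). This suggests f(A)x = ∫ h(s) T(s)(x - Ax) ds. With F = ⟨y,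
T(·)x⟩ and G = F - F' one has F̂ = (Ĝ - F(0))/(1 - z). The term F(0) f(z)/(1 - z) is orthogonal to
the Hardy space, so M_f F(t) = ∫ h(s) G(s + t) ds (`toeplitz_ae_eq_integral_kernel`). Uniqueness
holds because t ↦ ⟨y, f(A)T(t)x⟩ is continuous down to t = 0.

Moving contours onto the imaginary axis requires boundary limits of f almost everywhere, that is,
Fatou's theorem. A primitive of f is Lipschitz, hence differentiable at almost every point of the
axis; Phragmén–Lindelöf carries the first-order expansion into the half-plane, and a Cauchy estimate
recovers f. -/

lemma norm_le_norm_add_of_re_nonneg {z : ℂ} (hz : 0 ≤ z.re) {K : ℝ} (hK : 0 ≤ K) :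
    ‖z‖ ≤ ‖z + K‖ ∧ K ≤ ‖z + K‖ := by
  constructor
  · rw [Complex.norm_eq_sqrt_sq_add_sq, Complex.norm_eq_sqrt_sq_add_sq]
    apply Real.sqrt_le_sqrt
    simp only [Complex.add_re, Complex.ofReal_re, Complex.add_im, Complex.ofReal_im, add_zero]
    nlinarith [mul_nonneg hz hK]
  · refine le_trans ?_ (Complex.re_le_norm _)
    simp
    exact hz

lemma neg_inv_re_neg {z : ℂ} (hz : 0 < z.re) : (-z⁻¹).re < 0 := by
  have h0 : z ≠ 0 := fun h => by simp [h] at hz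
  rw [Complex.neg_re, Complex.inv_re, neg_lt_zero]
  exact div_pos hz (Complex.normSq_pos.2 h0)

/-- A holomorphic function on the left half-plane which is `O(z)`, continuous up to the boundary
and `o(z)` at the origin along the boundary is `o(z)` at the origin. -/
theorem isLittleO_of_isLittleO_boundary {E : ℂ → ℂ} {N : ℝ} (hc : Continuous E)
    (hd : DifferentiableOn ℂ E {z | z.re < 0}) (hN : ∀ z, ‖E z‖ ≤ N * ‖z‖)
    (hb : (fun w : ℝ => E (w * Complex.I)) =o[𝓝 0] fun w : ℝ => w) :
    E =o[𝓝[{z | z.re < 0}] 0] fun z => z := by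
  have hN0 : 0 ≤ N := by
    have := hN 1
    rw [norm_one, mul_one] at this
    exact (norm_nonneg _).trans this
  rw [Asymptotics.isLittleO_iff]
  intro c hc0
  set δ := c / 2 with hδ
  have hδ0 : 0 < δ := by positivity
  obtain ⟨ρ, hρ, hρb⟩ := Metric.eventually_nhds_iff.1 (Asymptotics.isLittleO_iff.1 hb hδ0)
  -- This K makes ‖ζ‖ / ‖ζ + K‖ small enough that ‖F‖ ≤ δ on the segment |η| < 2/ρ of the imaginary
  -- axis, where the smallness of `E` near 0 says nothing.
  set K : ℝ := (N + 1) * (2 / ρ) / δ with hK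
  have hK0 : 0 < K := by positivity
  -- The inversion ζ = -1/z swaps the two half-planes and sends the origin to infinity. The factor
  -- ζ²/(ζ + K) grows like ζ there, so a bound on `F` near infinity is a bound on E(z)/z near 0.
  set F : ℂ → ℂ := fun ζ => E (-ζ⁻¹) * (ζ ^ 2 / (ζ + K)) with hF
  have hne : ∀ ζ : ℂ, 0 ≤ ζ.re → ζ + K ≠ 0 := by
    intro ζ hζ h
    have := (norm_le_norm_add_of_re_nonneg hζ hK0.le).2
    rw [h, norm_zero] at this
    linarith
  have hE1 : ∀ ζ : ℂ, ‖E (-ζ⁻¹)‖ * ‖ζ‖ ≤ N := by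
    intro ζ
    by_cases h : ζ = 0
    · simp [h, hN0]
    · have := hN (-ζ⁻¹)
      rw [norm_neg, norm_inv] at this
      calc _ ≤ (N * ‖ζ‖⁻¹) * ‖ζ‖ := by gcongr
        _ = N := by
          have : ‖ζ‖ ≠ 0 := norm_ne_zero_iff.2 h
          field_simp
  have hFn : ∀ ζ, ‖F ζ‖ = (‖E (-ζ⁻¹)‖ * ‖ζ‖) * (‖ζ‖ / ‖ζ + K‖) := by
    intro ζ
    simp only [hF, norm_mul, norm_div, norm_pow]
    ring
  have hFN : ∀ ζ : ℂ, 0 ≤ ζ.re → ‖F ζ‖ ≤ N := by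
    intro ζ hζ
    rw [hFn]
    calc _ ≤ N * 1 := by
          gcongr
          · exact hE1 ζ
          · exact div_le_one_of_le₀ (norm_le_norm_add_of_re_nonneg hζ hK0.le).1 (norm_nonneg _)
      _ = N := mul_one N
  have hcl : DiffContOnCl ℂ F {z | 0 < z.re} := by
    constructor
    · intro ζ hζ
      have h0 : ζ ≠ 0 := fun h => by simp [h] at hζ
      have h1 : DifferentiableAt ℂ E (-ζ⁻¹) := (hd _ (neg_inv_re_neg hζ)).differentiableAt
        ((isOpen_lt Complex.continuous_re continuous_const).mem_nhds (neg_inv_re_neg hζ))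
      have h2 : DifferentiableAt ℂ (fun ζ : ℂ => -ζ⁻¹) ζ := (differentiableAt_inv h0).neg
      have h3 : DifferentiableAt ℂ (fun ζ : ℂ => ζ ^ 2 / (ζ + K)) ζ :=
        (by fun_prop : DifferentiableAt ℂ (fun ζ : ℂ => ζ ^ 2) ζ).div (by fun_prop)
          (hne ζ (le_of_lt hζ))
      exact ((DifferentiableAt.comp ζ h1 h2).mul h3).differentiableWithinAt
    · rw [Complex.closure_setOfPred_lt_re]
      intro ζ hζ
      -- Inversion is singular at 0, but `F 0 = 0` and ‖F ζ‖ ≤ N‖ζ‖/K give continuity there.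
      by_cases h0 : ζ = 0
      · subst h0
        have hF0 : F 0 = 0 := by simp [hF]
        rw [ContinuousWithinAt, hF0]
        refine squeeze_zero_norm' (a := fun ζ : ℂ => N * (‖ζ‖ / K)) ?_ ?_
        · filter_upwards [self_mem_nhdsWithin] with z hz
          rw [hFn]
          gcongr
          · exact hE1 z
          · exact (norm_le_norm_add_of_re_nonneg hz hK0.le).2
        · have : Continuous (fun ζ : ℂ => N * (‖ζ‖ / K)) := by fun_prop
          have := this.tendsto 0
          simp only [norm_zero, zero_div, mul_zero] at this
          exact this.mono_left nhdsWithin_le_nhds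
      · refine ContinuousAt.continuousWithinAt ?_
        refine ContinuousAt.mul (hc.continuousAt.comp (continuousAt_inv₀ h0).neg) ?_
        exact ContinuousAt.div (by fun_prop) (by fun_prop) (hne ζ hζ)
  -- `F` is bounded by `N` on the whole half-plane, so Phragmén–Lindelöf reduces the bound δ to the
  -- imaginary axis.
  have hFδ : ∀ ζ : ℂ, 0 ≤ ζ.re → ‖F ζ‖ ≤ δ := by
    intro ζ hζ
    refine PhragmenLindelof.right_half_plane_of_bounded_on_real hcl ⟨1, by norm_num, 0, ?_⟩
      ?_ ?_ hζ
    · simp only [zero_mul, Real.exp_zero]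
      refine Asymptotics.IsBigO.of_bound N ?_
      rw [eventually_inf_principal]
      refine Eventually.of_forall fun z hz => ?_
      simpa using hFN z (le_of_lt hz)
    · refine ⟨N, ?_⟩
      rw [eventually_map]
      filter_upwards [eventually_ge_atTop 0] with x hx
      exact hFN _ (by simpa using hx)
    · intro η
      rw [hFn]
      have hre : 0 ≤ ((η : ℂ) * Complex.I).re := by simp
      have hnη : ‖(η : ℂ) * Complex.I‖ = |η| := by simp
      by_cases hη : 2 / ρ ≤ |η|
      · have hη0 : 0 < |η| := lt_of_lt_of_le (by positivity) hη
        have hη1 : η ≠ 0 := abs_pos.1 hη0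
        have h1 : -((η : ℂ) * Complex.I)⁻¹ = ((η⁻¹ : ℝ) : ℂ) * Complex.I := by
          push_cast
          rw [mul_inv, Complex.inv_I]
          ring
        have h2 : dist (η⁻¹) 0 < ρ := by
          rw [dist_zero_right, norm_inv, Real.norm_eq_abs]
          rw [inv_lt_comm₀ hη0 hρ]
          refine lt_of_lt_of_le ?_ hη
          rw [inv_eq_one_div]
          gcongr
          norm_num
        have h3 := hρb h2
        rw [h1, hnη]
        calc _ ≤ (δ * ‖η⁻¹‖ * |η|) * 1 := by
              gcongr
              rw [← hnη]
              exact div_le_one_of_le₀ (norm_le_norm_add_of_re_nonneg hre hK0.le).1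
                (norm_nonneg _)
          _ = δ := by
              rw [norm_inv, Real.norm_eq_abs]
              field_simp
      · push Not at hη
        calc _ ≤ N * ((2 / ρ) / K) := by
              gcongr
              · exact hE1 _
              · rw [hnη]; exact hη.le
              · exact (norm_le_norm_add_of_re_nonneg hre hK0.le).2
          _ = N / (N + 1) * δ := by
              rw [hK]
              field_simp
          _ ≤ 1 * δ := by
              gcongr
              exact div_le_one_of_le₀ (by linarith) (by linarith)
          _ = δ := one_mul δ
  rw [eventually_nhdsWithin_iff, Metric.eventually_nhds_iff]
  -- For ‖z‖ < 1/K the point ζ = -1/z satisfies ‖ζ + K‖ ≤ 2‖ζ‖; this factor 2 is why δ = c/2.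
  refine ⟨1 / K, by positivity, fun z hz hz0 => ?_⟩
  rw [dist_zero_right] at hz
  have hzne : z ≠ 0 := fun h => by simp [h] at hz0
  have hzn : 0 < ‖z‖ := norm_pos_iff.2 hzne
  have hζ0 : 0 ≤ (-z⁻¹).re := by
    rw [Complex.neg_re, Complex.inv_re, neg_nonneg]
    exact div_nonpos_of_nonpos_of_nonneg (le_of_lt hz0) (Complex.normSq_nonneg _)
  have h1 := hFδ (-z⁻¹) hζ0
  rw [hFn] at h1
  have h2 : -(-z⁻¹)⁻¹ = z := by rw [inv_neg, inv_inv, neg_neg]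
  rw [h2, norm_neg, norm_inv] at h1
  have h3 : ‖-z⁻¹ + K‖ ≤ 2 * ‖z‖⁻¹ := by
    calc _ ≤ ‖-z⁻¹‖ + ‖(K : ℂ)‖ := norm_add_le _ _
      _ = ‖z‖⁻¹ + K := by
        rw [norm_neg, norm_inv, Complex.norm_real, Real.norm_eq_abs, abs_of_pos hK0]
      _ ≤ ‖z‖⁻¹ + ‖z‖⁻¹ := by
        gcongr
        rw [le_inv_comm₀ hK0 hzn, inv_eq_one_div]
        exact hz.le
      _ = _ := by ring
  have h4 : 0 < ‖-z⁻¹ + K‖ := norm_pos_iff.2 (hne _ hζ0)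
  have h5 : ‖E z‖ = (‖E z‖ * ‖z‖⁻¹ * (‖z‖⁻¹ / ‖-z⁻¹ + K‖)) * (‖-z⁻¹ + K‖ * ‖z‖ ^ 2) := by
    generalize ‖-z⁻¹ + K‖ = q at h4
    field_simp
  rw [h5]
  calc _ ≤ δ * ((2 * ‖z‖⁻¹) * ‖z‖ ^ 2) := by gcongr
    _ = c * ‖z‖ := by
      rw [hδ]
      field_simp

/-- **Fatou's theorem**: a bounded holomorphic function on the left half-plane has boundary limits
almost everywhere. -/
theorem HInfMinus.ae_exists_hasBoundaryLimit (g : HInfMinus) :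
    ∀ᵐ w : ℝ, ∃ l, HasBoundaryLimit g w l := by
  obtain ⟨M, hM⟩ := g.bdd
  have hconv : Convex ℝ {z : ℂ | z.re < 0} := convex_halfSpace_re_lt 0
  have hopen : IsOpen {z : ℂ | z.re < 0} := isOpen_lt Complex.continuous_re continuous_const
  -- A primitive of the bounded function g is Lipschitz, so it extends across the axis and is
  -- differentiable along it almost everywhere.
  obtain ⟨G, hG⟩ := hconv.exists_forall_hasDerivWithinAt g.holo
  have hlip : LipschitzOnWith M.toNNReal G {z : ℂ | z.re < 0} := by
    refine hconv.lipschitzOnWith_of_nnnorm_hasDerivWithin_le hG fun z hz => ?_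
    rw [← NNReal.coe_le_coe, coe_nnnorm]
    exact (hM z hz).trans (Real.le_coe_toNNReal M)
  obtain ⟨G', hG', hEq⟩ := hlip.extend_finite_dimension
  set L : ℝ≥0 := lipschitzExtensionConstant ℂ * M.toNNReal
  have hLB : LipschitzWith (L * 1) (fun w : ℝ => G' (w * Complex.I)) := by
    refine hG'.comp (LipschitzWith.of_dist_le_mul fun x y => ?_)
    rw [dist_eq_norm, ← sub_mul, norm_mul, Complex.norm_I, mul_one, ← Complex.ofReal_sub,
      Complex.norm_real, NNReal.coe_one, one_mul, dist_eq_norm]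
  filter_upwards [hLB.ae_differentiableAt_real] with w₀ hw₀
  obtain ⟨d, hd⟩ : ∃ d, HasDerivAt (fun w : ℝ => G' (w * Complex.I)) d w₀ := ⟨_, hw₀.hasDerivAt⟩
  refine ⟨d / Complex.I, ?_⟩
  -- The parameter w moves in the direction i, so the complex slope is d/i.
  set l : ℂ := d / Complex.I with hl
  set p : ℂ := w₀ * Complex.I with hp
  have hpre : p.re = 0 := by simp [hp]
  set E : ℂ → ℂ := fun z => G' (z + p) - G' p - l * z with hE
  have hEder : ∀ z : ℂ, z.re < 0 → HasDerivAt E (g (z + p) - l) z := by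
    intro z hz
    have hz' : (z + p).re < 0 := by rw [Complex.add_re, hpre, add_zero]; exact hz
    have h1 : HasDerivAt G (g (z + p)) (z + p) :=
      (hG _ hz').hasDerivAt (hopen.mem_nhds hz')
    have h2 : HasDerivAt G' (g (z + p)) (z + p) := by
      refine h1.congr_of_eventuallyEq ?_
      filter_upwards [hopen.mem_nhds hz'] with x hx
      exact (hEq hx).symm
    have h3 := h2.comp_add_const z p
    have h4 := (h3.sub_const (G' p)).sub ((hasDerivAt_id z).const_mul l)
    rw [mul_one] at h4
    exact h4
  have hlo : E =o[𝓝[{z | z.re < 0}] 0] fun z => z := by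
    refine isLittleO_of_isLittleO_boundary (N := L + ‖l‖) ?_ ?_ ?_ ?_
    · have := hG'.continuous
      fun_prop
    · exact fun z hz => (hEder z hz).differentiableAt.differentiableWithinAt
    · intro z
      calc ‖E z‖ ≤ ‖G' (z + p) - G' p‖ + ‖l * z‖ := norm_sub_le _ _
        _ ≤ L * ‖z‖ + ‖l‖ * ‖z‖ := by
          gcongr
          · have := hG'.dist_le_mul (z + p) p
            rwa [dist_eq_norm, dist_eq_norm, add_sub_cancel_right] at this
          · exact norm_mul_le _ _
        _ = _ := by ring
    · have h := hasDerivAt_iff_isLittleO_nhds_zero.1 hd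
      refine h.congr_left fun w => ?_
      simp only [hE, hp, hl, Complex.real_smul]
      have : (w : ℂ) * Complex.I + w₀ * Complex.I = ((w₀ + w : ℝ) : ℂ) * Complex.I := by
        push_cast; ring
      rw [this]
      have : d / Complex.I * (w * Complex.I) = w * d := by
        field_simp
      rw [this]
  rw [HasBoundaryLimit, Metric.tendsto_nhds]
  intro c hc
  -- On the disc of radius r/2 about -r one has ‖z‖ ≤ 3r/2, so Cauchy's estimate for E' gives
  -- (c/4)(3r/2)/(r/2) = 3c/4 < c.
  have h1 := Asymptotics.isLittleO_iff.1 hlo (c := c / 4) (by positivity)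
  rw [eventually_nhdsWithin_iff, Metric.eventually_nhds_iff] at h1
  obtain ⟨ρ, hρ, h1⟩ := h1
  filter_upwards [Ioo_mem_nhdsGT (show (0 : ℝ) < ρ / 2 by positivity)] with r hr
  have hr0 : 0 < r := hr.1
  have hball : ∀ z ∈ Metric.closedBall (-(r : ℂ)) (r / 2), z.re < 0 ∧ ‖z‖ ≤ 3 / 2 * r := by
    intro z hz
    rw [Metric.mem_closedBall, dist_eq_norm, sub_neg_eq_add] at hz
    have h2 := (Complex.re_le_norm _).trans hz
    rw [Complex.add_re, Complex.ofReal_re] at h2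
    refine ⟨by linarith, ?_⟩
    have h3 : ‖z‖ ≤ ‖z + r‖ + ‖(r : ℂ)‖ := by
      simpa using norm_sub_le (z + r) (r : ℂ)
    rw [Complex.norm_real, Real.norm_eq_abs, abs_of_pos hr0] at h3
    linarith
  have hder := hEder (-(r : ℂ)) (by simpa using hr0)
  have hdc : DiffContOnCl ℂ E (Metric.ball (-(r : ℂ)) (r / 2)) := by
    refine DifferentiableOn.diffContOnCl ?_
    rw [closure_ball _ (by positivity)]
    exact fun z hz => (hEder z (hball z hz).1).differentiableAt.differentiableWithinAt
  have hest := Complex.norm_deriv_le_of_forall_mem_sphere_norm_le (C := c / 4 * (3 / 2 * r))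
    (half_pos hr0) hdc fun z hz => by
      obtain ⟨h2, h3⟩ := hball z (Metric.sphere_subset_closedBall hz)
      refine (h1 ?_ h2).trans (by gcongr)
      rw [dist_zero_right]
      have := hr.2
      linarith
  rw [hder.deriv] at hest
  rw [dist_eq_norm]
  calc _ ≤ c / 4 * (3 / 2 * r) / (r / 2) := hest
    _ = 3 / 4 * c := by field_simp
    _ < c := by linarith

lemma HInfMinus.ae_hasBoundaryLimit_two_pi (g : HInfMinus) :
    ∀ᵐ ξ : ℝ, HasBoundaryLimit g (2 * Real.pi * ξ) (boundaryValue g (2 * Real.pi * ξ)) := by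
  have h : ∀ᵐ w : ℝ, HasBoundaryLimit g w (boundaryValue g w) := by
    filter_upwards [g.ae_exists_hasBoundaryLimit] with w ⟨l, hl⟩
    rwa [hl.boundaryValue_eq]
  have hq : Measure.QuasiMeasurePreserving (fun ξ : ℝ => 2 * Real.pi * ξ) volume volume := by
    refine ⟨by fun_prop, ?_⟩
    rw [Real.map_volume_mul_left (by positivity)]
    exact Measure.smul_absolutelyContinuous
  exact hq.ae h


/-! ### Shifting vertical contours -/

lemma integrable_const_div_one_add_sq (C : ℝ) : Integrable fun w : ℝ => C / (1 + w ^ 2) := by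
  simpa [div_eq_mul_inv] using integrable_inv_one_add_sq.const_mul C

lemma tendsto_const_div_one_add_sq (C : ℝ) {l : Filter ℝ} {u : ℝ → ℝ}
    (hu : Tendsto (fun x => |u x|) l atTop) : Tendsto (fun x => C / (1 + u x ^ 2)) l (𝓝 0) := by
  refine Tendsto.div_atTop tendsto_const_nhds ?_
  refine tendsto_atTop_add_const_left _ _ ?_
  simp_rw [← sq_abs (u _)]
  exact (tendsto_pow_atTop two_ne_zero).comp hu

/-- The integral over a vertical line does not depend on the line. -/
theorem integral_vertical_eq {H : ℂ → ℂ} {a b C : ℝ}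
    (hd : DifferentiableOn ℂ H {z | a < z.re ∧ z.re < b})
    (hC : ∀ z : ℂ, a < z.re → z.re < b → ‖H z‖ ≤ C / (1 + z.im ^ 2))
    {s t : ℝ} (hs : s ∈ Ioo a b) (ht : t ∈ Ioo a b) :
    ∫ w : ℝ, H (s + w * Complex.I) = ∫ w : ℝ, H (t + w * Complex.I) := by
  have hint : ∀ s ∈ Ioo a b, Integrable fun w : ℝ => H (s + w * Complex.I) := by
    intro s hs
    refine (integrable_const_div_one_add_sq C).mono' ?_ (Eventually.of_forall fun w => ?_)
    · refine (hd.continuousOn.comp_continuous (by fun_prop) fun w => ?_).aestronglyMeasurable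
      simpa using hs
    · simpa using hC (s + w * Complex.I) (by simpa using hs.1) (by simpa using hs.2)
  have hlim : ∀ s ∈ Ioo a b, Tendsto (fun T : ℝ => ∫ w in (-T)..T, H (s + w * Complex.I)) atTop
      (𝓝 (∫ w : ℝ, H (s + w * Complex.I))) := fun s hs =>
    intervalIntegral_tendsto_integral (hint s hs) tendsto_neg_atTop_atBot tendsto_id
  have hmem : ∀ x ∈ uIcc s t, x ∈ Ioo a b := fun x hx =>
    ordConnected_Ioo.uIcc_subset hs ht hx
  -- The horizontal sides of the rectangle vanish in the limit; u is T or -T.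
  have hhor : ∀ u : ℝ → ℝ, Tendsto (fun x => |u x|) atTop atTop →
      Tendsto (fun T : ℝ => ∫ x in s..t, H (x + u T * Complex.I)) atTop (𝓝 0) := by
    intro u hu
    refine squeeze_zero_norm (a := fun T => C / (1 + u T ^ 2) * |t - s|) (fun T => ?_) ?_
    · refine intervalIntegral.norm_integral_le_of_norm_le_const fun x hx => ?_
      have hx' := hmem x (uIoc_subset_uIcc hx)
      simpa using hC (x + u T * Complex.I) (by simpa using hx'.1) (by simpa using hx'.2)
    · simpa using (tendsto_const_div_one_add_sq C hu).mul_const |t - s|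
  have hrect : ∀ T : ℝ, (∫ x in s..t, H (x + ((-T : ℝ) : ℂ) * Complex.I))
      - (∫ x in s..t, H (x + (T : ℂ) * Complex.I))
      + Complex.I • (∫ w in (-T)..T, H (t + w * Complex.I))
      - Complex.I • (∫ w in (-T)..T, H (s + w * Complex.I)) = 0 := by
    intro T
    have := Complex.integral_boundary_rect_eq_zero_of_differentiableOn H (⟨s, -T⟩ : ℂ) (⟨t, T⟩ : ℂ)
      (hd.mono fun z hz => hmem _ hz.1)
    simpa using this
  have hl := (((hhor (fun T => -T) (by simpa using tendsto_abs_atTop_atTop)).sub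
    (hhor (fun T => T) tendsto_abs_atTop_atTop)).add ((hlim t ht).const_smul Complex.I)).sub
    ((hlim s hs).const_smul Complex.I)
  have h0 := tendsto_nhds_unique hl (tendsto_const_nhds.congr fun T => (hrect T).symm)
  rw [sub_zero, zero_add, ← smul_sub, smul_eq_zero, sub_eq_zero] at h0
  exact (h0.resolve_left Complex.I_ne_zero).symm

lemma integral_vertical_two_pi_eq {H : ℂ → ℂ} {a b C : ℝ}
    (hd : DifferentiableOn ℂ H {z | a < z.re ∧ z.re < b})
    (hC : ∀ z : ℂ, a < z.re → z.re < b → ‖H z‖ ≤ C / (1 + z.im ^ 2))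
    {s t : ℝ} (hs : s ∈ Ioo a b) (ht : t ∈ Ioo a b) :
    ∫ ξ : ℝ, H (s + (2 * Real.pi * ξ : ℝ) * Complex.I)
      = ∫ ξ : ℝ, H (t + (2 * Real.pi * ξ : ℝ) * Complex.I) := by
  rw [Measure.integral_comp_mul_left (fun w : ℝ => H (s + w * Complex.I)) (2 * Real.pi),
    Measure.integral_comp_mul_left (fun w : ℝ => H (t + w * Complex.I)) (2 * Real.pi),
    integral_vertical_eq hd hC hs ht]

/-- The integral over a vertical line equals the integral of the boundary values on the imaginary
axis. -/
theorem integral_boundary_eq_integral_vertical {H : ℂ → ℂ} {Hb : ℝ → ℂ} {R C : ℝ}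
    (hd : DifferentiableOn ℂ H {z | -R < z.re ∧ z.re < 0})
    (hC : ∀ z : ℂ, -R < z.re → z.re < 0 → ‖H z‖ ≤ C / (1 + z.im ^ 2))
    (hb : ∀ᵐ ξ : ℝ, Tendsto (fun r : ℝ => H (-(r : ℂ) + (2 * Real.pi * ξ : ℝ) * Complex.I))
      (𝓝[>] 0) (𝓝 (Hb ξ))) {r : ℝ} (hr : 0 < r) (hrR : r < R) :
    ∫ ξ, Hb ξ = ∫ ξ : ℝ, H (-(r : ℂ) + (2 * Real.pi * ξ : ℝ) * Complex.I) := by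
  have hR : 0 < R := hr.trans hrR
  have h1 : Tendsto (fun r : ℝ => ∫ ξ : ℝ, H (-(r : ℂ) + (2 * Real.pi * ξ : ℝ) * Complex.I))
      (𝓝[>] 0) (𝓝 (∫ ξ, Hb ξ)) := by
    refine tendsto_integral_filter_of_dominated_convergence
      (fun ξ : ℝ => C / (1 + (2 * Real.pi * ξ) ^ 2)) ?_ ?_ ?_ hb
    · filter_upwards [Ioo_mem_nhdsGT hR] with s hs
      refine (hd.continuousOn.comp_continuous (by fun_prop) fun w => ?_).aestronglyMeasurable
      simpa using hs.symm
    · filter_upwards [Ioo_mem_nhdsGT hR] with s hs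
      refine Eventually.of_forall fun ξ => ?_
      simpa using hC (-(s : ℂ) + (2 * Real.pi * ξ : ℝ) * Complex.I) (by simpa using hs.2)
        (by simpa using hs.1)
    · exact (integrable_const_div_one_add_sq C).comp_mul_left' (by positivity)
  refine tendsto_nhds_unique h1 (tendsto_const_nhds.congr' ?_)
  filter_upwards [Ioo_mem_nhdsGT hR] with s hs
  have := integral_vertical_two_pi_eq hd hC (s := -r) (t := -s) (by simpa using ⟨hrR, hr⟩)
    (by simpa using hs.symm)
  simpa using this


/-! ### Absolutely convergent Laplace integrals -/

/-- The Laplace integral `∫₀^∞ e^{-zt} F(t) dt`. -/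
def laplaceIntegral (F : ℝ → ℂ) (z : ℂ) : ℂ := ∫ t in Ioi (0 : ℝ), Complex.exp (-(z * t)) * F t

lemma norm_exp_neg_mul (z : ℂ) (t : ℝ) : ‖Complex.exp (-(z * t))‖ = Real.exp (-(z.re * t)) := by
  rw [Complex.norm_exp]
  simp

lemma norm_exp_mul_le {F : ℝ → ℂ} {c ω t : ℝ} (ht : ‖F t‖ ≤ c * Real.exp (-ω * t)) (z : ℂ) :
    ‖Complex.exp (-(z * t)) * F t‖ ≤ c * Real.exp (-(z.re + ω) * t) := by
  rw [norm_mul, norm_exp_neg_mul]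
  calc _ ≤ Real.exp (-(z.re * t)) * (c * Real.exp (-ω * t)) := by gcongr
    _ = c * (Real.exp (-(z.re * t)) * Real.exp (-ω * t)) := by ring
    _ = _ := by
      rw [← Real.exp_add]
      ring_nf

lemma integrableOn_exp_mul {F : ℝ → ℂ} {c ω : ℝ}
    (hm : AEStronglyMeasurable F (volume.restrict (Ioi 0)))
    (hF : ∀ t > 0, ‖F t‖ ≤ c * Real.exp (-ω * t)) {z : ℂ} (hz : -ω < z.re) :
    IntegrableOn (fun t : ℝ => Complex.exp (-(z * t)) * F t) (Ioi 0) := by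
  refine ((exp_neg_integrableOn_Ioi 0 (b := z.re + ω) (by linarith)).const_mul c).mono'
    ((by fun_prop : Continuous fun t : ℝ => Complex.exp (-(z * t))).aestronglyMeasurable.mul hm) ?_
  filter_upwards [ae_restrict_mem measurableSet_Ioi] with t ht
  exact norm_exp_mul_le (hF t ht) z

lemma differentiableAt_laplaceIntegral {F : ℝ → ℂ} {c ω : ℝ}
    (hm : AEStronglyMeasurable F (volume.restrict (Ioi 0)))
    (hF : ∀ t > 0, ‖F t‖ ≤ c * Real.exp (-ω * t)) {z : ℂ} (hz : -ω < z.re) :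
    DifferentiableAt ℂ (laplaceIntegral F) z := by
  -- On the ball of radius δ decay at rate 2δ is still available. The factor t produced by
  -- differentiation costs e^{δt}/δ, leaving the integrable e^{-δt}.
  set δ := (z.re + ω) / 4 with hδ
  have hδ0 : 0 < δ := by
    rw [hδ]
    linarith
  have hball : ∀ x ∈ Metric.ball z δ, 2 * δ - ω ≤ x.re := by
    intro x hx
    rw [Metric.mem_ball, dist_eq_norm] at hx
    have := (abs_le.1 (Complex.abs_re_le_norm (x - z))).1
    rw [Complex.sub_re] at this
    linarith
  refine (hasDerivAt_integral_of_dominated_loc_of_deriv_le (𝕜 := ℂ)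
    (μ := volume.restrict (Ioi (0 : ℝ)))
    (F := fun (z : ℂ) (t : ℝ) => Complex.exp (-(z * t)) * F t)
    (F' := fun (z : ℂ) (t : ℝ) => (Complex.exp (-(z * t)) * -t) * F t)
    (bound := fun t => c / δ * Real.exp (-δ * t)) (Metric.ball_mem_nhds z hδ0)
    (Eventually.of_forall fun x => ?_) (integrableOn_exp_mul hm hF hz) ?_ ?_ ?_ ?_).2.differentiableAt
  · exact (by fun_prop : Continuous fun t : ℝ => Complex.exp (-(x * t))).aestronglyMeasurable.mul hm
  · exact (by fun_prop : Continuous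
      fun t : ℝ => Complex.exp (-(z * t)) * -t).aestronglyMeasurable.mul hm
  · filter_upwards [ae_restrict_mem measurableSet_Ioi] with t ht x hx
    have ht0 : (0 : ℝ) < t := ht
    have h1 := norm_exp_mul_le (hF t ht) x
    have hc : 0 ≤ c := by
      have := (norm_nonneg _).trans (hF t ht)
      exact nonneg_of_mul_nonneg_left this (Real.exp_pos _)
    have h2 : ‖Complex.exp (-(x * t)) * -t * F t‖ = t * ‖Complex.exp (-(x * t)) * F t‖ := by
      simp only [norm_mul, norm_neg, Complex.norm_real, Real.norm_eq_abs, abs_of_pos ht0]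
      ring
    rw [h2]
    have h3 : δ * t ≤ Real.exp (δ * t) := (by linarith [Real.add_one_le_exp (δ * t)])
    calc _ ≤ t * (c * Real.exp (-(2 * δ) * t)) := by
          refine mul_le_mul_of_nonneg_left (h1.trans ?_) ht0.le
          gcongr
          linarith [hball x hx]
      _ = c / δ * (δ * t) * Real.exp (-(2 * δ) * t) := by field_simp
      _ ≤ c / δ * Real.exp (δ * t) * Real.exp (-(2 * δ) * t) := by gcongr
      _ = c / δ * Real.exp (-δ * t) := by
        rw [mul_assoc, ← Real.exp_add]
        ring_nf
  · exact (exp_neg_integrableOn_Ioi 0 hδ0).const_mul _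
  · refine Eventually.of_forall fun t x _ => ?_
    have h1 : HasDerivAt (fun z : ℂ => -(z * t)) (-t) x := by
      have h := ((hasDerivAt_id x).mul_const (t : ℂ)).neg
      rw [one_mul] at h
      exact h
    exact h1.cexp.mul_const (F t)

lemma norm_laplaceIntegral_le {F : ℝ → ℂ} {c ω r : ℝ} (hr : -ω < r)
    (hF : ∀ t > 0, ‖F t‖ ≤ c * Real.exp (-ω * t)) {z : ℂ} (hz : r ≤ z.re) :
    ‖laplaceIntegral F z‖ ≤ ∫ t in Ioi (0 : ℝ), c * Real.exp (-(r + ω) * t) := by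
  refine norm_integral_le_of_norm_le
    ((exp_neg_integrableOn_Ioi 0 (b := r + ω) (by linarith)).const_mul c) ?_
  filter_upwards [ae_restrict_mem measurableSet_Ioi] with t ht
  have ht0 : (0 : ℝ) < t := ht
  have hc : 0 ≤ c := nonneg_of_mul_nonneg_left ((norm_nonneg _).trans (hF t ht)) (Real.exp_pos _)
  refine (norm_exp_mul_le (hF t ht) z).trans ?_
  gcongr

/-! ### Laplace integrals of test functions -/

/-- Smooth real functions with compact support in `(0,∞)`. -/
structure IsTestFun (K : ℝ → ℝ) : Prop where
  contDiff : ContDiff ℝ (⊤ : ℕ∞) K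
  compact : HasCompactSupport K
  subset : tsupport K ⊆ Ioi 0

namespace IsTestFun

variable {K : ℝ → ℝ}

lemma eq_zero (hK : IsTestFun K) {t : ℝ} (ht : t ≤ 0) : K t = 0 := by
  by_contra h
  exact absurd (hK.subset (subset_tsupport K h)) (not_lt.2 ht)

lemma deriv (hK : IsTestFun K) : IsTestFun (deriv K) where
  contDiff := (contDiff_infty_iff_deriv.1 hK.contDiff).2
  compact := hK.compact.deriv
  subset := (closure_minimal (support_deriv_subset) (isClosed_tsupport K)).trans hK.subset

lemma exp_mul (hK : IsTestFun K) (ε : ℝ) : IsTestFun fun t => Real.exp (ε * t) * K t where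
  contDiff := (by fun_prop : ContDiff ℝ (⊤ : ℕ∞) fun t : ℝ => Real.exp (ε * t)).mul hK.contDiff
  compact := hK.compact.mul_left
  subset := (closure_mono (Function.support_mul_subset_right _ _)).trans hK.subset

lemma continuous_ofReal (hK : IsTestFun K) : Continuous fun t => (K t : ℂ) :=
  Complex.continuous_ofReal.comp hK.contDiff.continuous

lemma hasCompactSupport_ofReal (hK : IsTestFun K) : HasCompactSupport fun t => (K t : ℂ) :=
  hK.compact.comp_left Complex.ofReal_zero

lemma integrable (hK : IsTestFun K) : Integrable fun t => (K t : ℂ) :=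
  hK.continuous_ofReal.integrable_of_hasCompactSupport hK.hasCompactSupport_ofReal

lemma memLp (hK : IsTestFun K) (p : ℝ≥0∞) : MemLp (fun t => (K t : ℂ)) p :=
  hK.continuous_ofReal.memLp_of_hasCompactSupport hK.hasCompactSupport_ofReal

/-- The rate ω is arbitrary because the support is compact; hence the Laplace integral is entire. -/
lemma exists_exp_bound (hK : IsTestFun K) (ω : ℝ) :
    ∃ c, ∀ t > 0, ‖(K t : ℂ)‖ ≤ c * Real.exp (-ω * t) := by
  obtain ⟨c, hc⟩ := (hK.exp_mul ω).compact.exists_bound_of_continuous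
    (hK.exp_mul ω).contDiff.continuous
  refine ⟨c, fun t _ => ?_⟩
  have := hc t
  rw [norm_mul, Real.norm_eq_abs, Real.abs_exp, Real.norm_eq_abs] at this
  rw [Complex.norm_real, Real.norm_eq_abs, neg_mul, Real.exp_neg]
  rw [← div_eq_mul_inv, le_div_iff₀ (Real.exp_pos _), mul_comm]
  exact this

lemma laplaceIntegral_eq (hK : IsTestFun K) (z : ℂ) :
    laplaceIntegral (fun t => (K t : ℂ)) z = ∫ t : ℝ, Complex.exp (-(z * t)) * K t := by
  refine setIntegral_eq_integral_of_forall_compl_eq_zero fun t ht => ?_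
  simp only [hK.eq_zero (not_lt.1 ht), Complex.ofReal_zero, mul_zero]

lemma differentiable_laplaceIntegral (hK : IsTestFun K) :
    Differentiable ℂ (laplaceIntegral fun t => (K t : ℂ)) := by
  intro z
  obtain ⟨c, hc⟩ := hK.exists_exp_bound (-z.re + 1)
  exact differentiableAt_laplaceIntegral hK.continuous_ofReal.aestronglyMeasurable hc (by linarith)

lemma integrable_exp_mul (hK : IsTestFun K) (z : ℂ) :
    Integrable fun t : ℝ => Complex.exp (-(z * t)) * K t :=
  (by have := hK.continuous_ofReal
      fun_prop : Continuous
        fun t : ℝ => Complex.exp (-(z * t)) * K t).integrable_of_hasCompactSupport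
    hK.hasCompactSupport_ofReal.mul_left

lemma laplaceIntegral_deriv (hK : IsTestFun K) (z : ℂ) :
    laplaceIntegral (fun t => ((_root_.deriv K t : ℝ) : ℂ)) z
      = z * laplaceIntegral (fun t => (K t : ℂ)) z := by
  rw [hK.laplaceIntegral_eq, hK.deriv.laplaceIntegral_eq]
  have h := integral_mul_deriv_eq_deriv_mul_of_integrable
    (u := fun t : ℝ => Complex.exp (-(z * t))) (v := fun t : ℝ => (K t : ℂ))
    (u' := fun t : ℝ => Complex.exp (-(z * t)) * -z) (v' := fun t : ℝ => ((_root_.deriv K t : ℝ) : ℂ))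
    (fun t _ => ?_) (fun t _ => ?_) (hK.deriv.integrable_exp_mul z) ?_ (hK.integrable_exp_mul z)
  · rw [h, ← integral_neg, ← integral_const_mul]
    refine integral_congr_ae (Eventually.of_forall fun t => ?_)
    ring
  · have h1 : HasDerivAt (fun t : ℝ => -(z * (t : ℂ))) (-z) t := by
      have h := ((Complex.ofRealCLM.hasDerivAt (x := t)).const_mul z).neg
      rw [Complex.ofRealCLM_apply, Complex.ofReal_one, mul_one] at h
      exact h
    exact h1.cexp
  · exact (((hK.contDiff.differentiable (by simp)) t).hasDerivAt).ofReal_comp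
  · refine ((hK.integrable_exp_mul z).const_mul (-z)).congr (Eventually.of_forall fun t => ?_)
    simp only [Pi.mul_apply]
    ring

/-- Two derivatives give z²K̂ = (K'')^, and both K̂ and (K'')^ are bounded on Re z ≥ r. The
quadratic decay supplies the majorant needed for moving contours. -/
lemma exists_laplaceIntegral_bound (hK : IsTestFun K) (r : ℝ) :
    ∃ C, 0 ≤ C ∧ ∀ z : ℂ, r ≤ z.re →
      ‖laplaceIntegral (fun t => (K t : ℂ)) z‖ ≤ C / (1 + z.im ^ 2) := by
  obtain ⟨c₁, h₁⟩ := hK.exists_exp_bound (-r + 1)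
  obtain ⟨c₂, h₂⟩ := hK.deriv.deriv.exists_exp_bound (-r + 1)
  have hb₁ := fun (z : ℂ) hz => norm_laplaceIntegral_le (r := r) (by linarith) h₁ (z := z) hz
  have hb₂ := fun (z : ℂ) hz => norm_laplaceIntegral_le (r := r) (by linarith) h₂ (z := z) hz
  refine ⟨_, add_nonneg ((norm_nonneg _).trans (hb₁ r (by simp)))
    ((norm_nonneg _).trans (hb₂ r (by simp))), fun z hz => ?_⟩
  rw [le_div_iff₀ (by positivity), mul_add, mul_one]
  refine add_le_add (hb₁ z hz) (le_trans ?_ (hb₂ z hz))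
  rw [hK.deriv.laplaceIntegral_deriv, hK.laplaceIntegral_deriv, ← mul_assoc, norm_mul, mul_comm,
    norm_mul]
  gcongr
  rw [sq, ← abs_mul_abs_self]
  have := Complex.abs_im_le_norm z
  gcongr

end IsTestFun


/-! ### The Fourier transform on `L²` -/

open FourierTransform SchwartzMap in
/-- The Fourier transform on `L²` is self-adjoint for the bilinear pairing. -/
theorem integral_fourier_mul_eq (u v : L2Line) :
    ∫ ξ, (𝓕 u : L2Line) ξ * v ξ = ∫ x, u x * (𝓕 v : L2Line) x := by
  have hp : ∀ u v : L2Line, ∫ x, u x * v x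
      = (ContinuousLinearMap.mul ℂ ℂ).lpPairing volume 2 2 u v := fun u v => by
    rw [ContinuousLinearMap.lpPairing_eq_integral]
    rfl
  rw [hp, hp]
  refine DenseRange.induction_on
    (p := fun v : L2Line => (ContinuousLinearMap.mul ℂ ℂ).lpPairing volume 2 2 (𝓕 u : L2Line) v
      = (ContinuousLinearMap.mul ℂ ℂ).lpPairing volume 2 2 u (𝓕 v : L2Line))
    (SchwartzMap.denseRange_toLpCLM (E := ℝ) (F := ℂ) (p := 2) (μ := volume)
      ENNReal.ofNat_ne_top) v ?_ ?_
  · refine isClosed_eq (ContinuousLinearMap.continuous _) ?_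
    exact (ContinuousLinearMap.continuous _).comp (Lp.fourierTransformₗᵢ ℝ ℂ).continuous
  · intro ψ
    change (ContinuousLinearMap.mul ℂ ℂ).lpPairing volume 2 2 (𝓕 u : L2Line) (ψ.toLp 2)
      = (ContinuousLinearMap.mul ℂ ℂ).lpPairing volume 2 2 u (𝓕 (ψ.toLp 2) : L2Line)
    rw [SchwartzMap.toLp_fourier_eq, ← hp, ← hp]
    -- Against a Schwartz function the identity is the definition of the Fourier transform of the
    -- tempered distribution `u`.
    have h := congrArg (fun d => d ψ) (Lp.fourier_toTemperedDistribution_eq u)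
    simp only [TemperedDistribution.fourier_apply, Lp.toTemperedDistribution_apply] at h
    have h1 : ∫ ξ, (𝓕 u : L2Line) ξ * (ψ.toLp 2 : L2Line) ξ = ∫ ξ, ψ ξ • (𝓕 u : L2Line) ξ := by
      refine integral_congr_ae ?_
      filter_upwards [ψ.coeFn_toLp 2 volume] with ξ hξ
      rw [hξ, smul_eq_mul, mul_comm]
    have h2 : ∫ x, u x * ((𝓕 ψ).toLp 2 : L2Line) x = ∫ x, (𝓕 ψ) x • u x := by
      refine integral_congr_ae ?_
      filter_upwards [(𝓕 ψ).coeFn_toLp 2 volume] with ξ hξ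
      rw [hξ, smul_eq_mul, mul_comm]
    rw [h1, h2, h]

open FourierTransform SchwartzMap in
/-- On `L¹ ∩ L²` the Fourier transform of `L²` is given by the Fourier integral. -/
theorem fourier_toLp_ae_eq {u : ℝ → ℂ} (h1 : Integrable u) (h2 : MemLp u 2) :
    (𝓕 (h2.toLp : L2Line) : L2Line) =ᵐ[volume] 𝓕 u := by
  have hcont : Continuous (𝓕 u) := VectorFourier.fourierIntegral_continuous
    Real.continuous_fourierChar (innerSL ℝ).continuous₂ h1
  refine ae_eq_of_integral_contDiff_smul_eq
    ((Lp.memLp _).locallyIntegrable (by norm_num)) hcont.locallyIntegrable ?_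
  intro g hg hgc
  have hgc' : HasCompactSupport fun x => (g x : ℂ) := hgc.comp_left Complex.ofReal_zero
  have hg' : ContDiff ℝ (⊤ : ℕ∞) fun x => (g x : ℂ) := Complex.ofRealCLM.contDiff.comp hg
  set ψ : 𝓢(ℝ, ℂ) := hgc'.toSchwartzMap hg' with hψ
  have hψc : ∀ x, ψ x = g x := fun x => rfl
  have e1 : ∫ x, g x • (𝓕 (h2.toLp : L2Line) : L2Line) x
      = ∫ x, (𝓕 (h2.toLp : L2Line) : L2Line) x * (ψ.toLp 2 : L2Line) x := by
    refine integral_congr_ae ?_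
    filter_upwards [ψ.coeFn_toLp 2 volume] with x hx
    rw [hx, hψc, Complex.real_smul, mul_comm]
  have e2 : ∫ x, (h2.toLp : L2Line) x * (𝓕 (ψ.toLp 2 : L2Line) : L2Line) x
      = ∫ x, u x • (𝓕 (ψ : ℝ → ℂ)) x := by
    rw [SchwartzMap.toLp_fourier_eq]
    refine integral_congr_ae ?_
    filter_upwards [(𝓕 ψ).coeFn_toLp 2 volume, h2.coeFn_toLp] with x hx hx'
    rw [hx, hx', smul_eq_mul]
    rfl
  rw [e1, integral_fourier_mul_eq, e2]
  have h := VectorFourier.integral_fourierIntegral_smul_eq_flip (μ := volume) (ν := volume)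
    (f := u) (g := (ψ : ℝ → ℂ)) (L := (innerₗ ℝ : ℝ →ₗ[ℝ] ℝ →ₗ[ℝ] ℝ)) Real.continuous_fourierChar
    (by exact continuous_inner) h1 ψ.integrable
  rw [flip_innerₗ] at h
  refine h.symm.trans (integral_congr_ae (Eventually.of_forall fun x => ?_))
  simp only [hψc, smul_eq_mul, Complex.real_smul]
  rw [mul_comm]
  rfl

open FourierTransform in
lemma fourier_indicator_Ioi (F : ℝ → ℂ) (ξ : ℝ) :
    𝓕 ((Ioi (0 : ℝ)).indicator F) ξ
      = laplaceIntegral F ((2 * Real.pi * ξ : ℝ) * Complex.I) := by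
  rw [Real.fourier_real_eq_integral_exp_smul, laplaceIntegral, ← integral_indicator measurableSet_Ioi]
  refine integral_congr_ae (Eventually.of_forall fun t => ?_)
  by_cases ht : t ∈ Ioi (0 : ℝ)
  · simp only [indicator_of_mem ht, smul_eq_mul]
    congr 2
    push_cast
    ring
  · simp only [indicator_of_notMem ht, smul_zero]

/-- The Laplace transform of an integrable function in `L²(0,∞)` is given by its Laplace
integral. -/
theorem laplace_toLp_ae_eq {F : ℝ → ℂ} (h1 : IntegrableOn F (Ioi 0))
    (h2 : MemLp F 2 (volume.restrict (Ioi 0))) :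
    laplace h2.toLp =ᵐ[volume]
      fun ξ : ℝ => laplaceIntegral F ((2 * Real.pi * ξ : ℝ) * Complex.I) := by
  have h2' : MemLp ((Ioi (0 : ℝ)).indicator F) 2 :=
    (memLp_indicator_iff_restrict measurableSet_Ioi).2 h2
  have he : extendZero h2.toLp = h2'.toLp := by
    change (memLp_indicator_L2Pos h2.toLp).toLp = h2'.toLp
    rw [MemLp.toLp_eq_toLp_iff]
    exact (ae_eq_restrict_iff_indicator_ae_eq measurableSet_Ioi).1 h2.coeFn_toLp
  have h := fourier_toLp_ae_eq ((integrable_indicator_iff measurableSet_Ioi).2 h1) h2'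
  rw [← he] at h
  refine EventuallyEq.trans h (Eventually.of_forall fun ξ => fourier_indicator_Ioi F ξ)


/-! ### Testing Toeplitz operators -/

open ComplexConjugate in
lemma IsTestFun.conj_laplaceIntegral {K : ℝ → ℝ} (z : ℂ) :
    conj (laplaceIntegral (fun t => (K t : ℂ)) z) = laplaceIntegral (fun t => (K t : ℂ)) (conj z) := by
  rw [laplaceIntegral, laplaceIntegral, ← integral_conj]
  refine integral_congr_ae (Eventually.of_forall fun t => ?_)
  simp [← Complex.exp_conj]

/-- The Laplace transform is isometric, and the projection drops out because `laplace v` already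
lies in the Hardy space. -/
lemma toeplitz_inner (g : HInfMinus) (v u : L2Pos) :
    inner ℂ v (toeplitz g u) = inner ℂ (laplace v) (g.boundary • laplace u : L2Line) := by
  have h1 : ∀ p : hardy, laplace (laplaceInv p) = p := fun p =>
    congrArg Subtype.val (laplace.equivRange.apply_symm_apply p)
  rw [← laplace.inner_map_map v, toeplitz, h1]
  exact hardy.inner_orthogonalProjectionOnto_eq_of_mem_left ⟨laplace v, v, rfl⟩ _

/-- As K is real, conjugating K̂(iw) gives K̂(-iw), the boundary value of z ↦ K̂(-z). The integrand
thereby becomes accessible to contour shifts in the left half-plane. -/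
theorem IsTestFun.integral_mul_toeplitz {K : ℝ → ℝ} (hK : IsTestFun K) (g : HInfMinus)
    (u : L2Pos) :
    ∫ t in Ioi (0 : ℝ), (K t : ℂ) * toeplitz g u t
      = ∫ ξ : ℝ, laplaceIntegral (fun t => (K t : ℂ)) (-((2 * Real.pi * ξ : ℝ) * Complex.I))
        * (boundaryValue g (2 * Real.pi * ξ) * laplace u ξ) := by
  have hK2 : MemLp (fun t => (K t : ℂ)) 2 (volume.restrict (Ioi 0)) := (hK.memLp 2).restrict _
  have h := toeplitz_inner g hK2.toLp u
  rw [L2.inner_def, L2.inner_def] at h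
  have e1 : ∫ t in Ioi (0 : ℝ), inner ℂ ((hK2.toLp : L2Pos) t) (toeplitz g u t)
      = ∫ t in Ioi (0 : ℝ), (K t : ℂ) * toeplitz g u t := by
    refine integral_congr_ae ?_
    filter_upwards [hK2.coeFn_toLp] with t ht
    rw [ht, RCLike.inner_apply, Complex.conj_ofReal, mul_comm]
  rw [← e1, h]
  refine integral_congr_ae ?_
  have hb : (g.boundary : ℝ → ℂ) =ᵐ[volume] fun ξ => boundaryValue g (2 * Real.pi * ξ) :=
    MemLp.coeFn_toLp _
  filter_upwards [laplace_toLp_ae_eq hK.integrable.integrableOn hK2,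
    Lp.coeFn_lpSMul (r := 2) g.boundary (laplace u), hb] with ξ h1 h2 h3
  rw [h1, h2, RCLike.inner_apply, Pi.smul_apply', h3, IsTestFun.conj_laplaceIntegral, smul_eq_mul,
    mul_comm, map_mul, Complex.conj_I, Complex.conj_ofReal, mul_neg]

/-- Locally integrable functions on `(0,∞)` are determined by their integrals against test
functions. -/
theorem ae_eq_of_integral_testFun {u v : ℝ → ℂ}
    (hu : LocallyIntegrable u (volume.restrict (Ioi 0)))
    (hv : LocallyIntegrable v (volume.restrict (Ioi 0)))
    (h : ∀ K, IsTestFun K → ∫ t in Ioi (0 : ℝ), (K t : ℂ) * u t = ∫ t in Ioi (0 : ℝ), (K t : ℂ) * v t) :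
    u =ᵐ[volume.restrict (Ioi 0)] v := by
  have h0 := isOpen_Ioi.ae_eq_zero_of_integral_contDiff_smul_eq_zero (U := Ioi (0 : ℝ))
    (f := u - v) (μ := volume)
    (locallyIntegrableOn_of_locallyIntegrable_restrict (hu.sub hv)) ?_
  · rw [EventuallyEq, ae_restrict_iff' measurableSet_Ioi]
    filter_upwards [h0] with t ht ht0
    exact sub_eq_zero.1 (ht ht0)
  · intro g hg hgc hgs
    have hK : IsTestFun g := ⟨hg, hgc, hgs⟩
    have hint : ∀ w : ℝ → ℂ, LocallyIntegrable w (volume.restrict (Ioi 0)) →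
        IntegrableOn (fun t => (g t : ℂ) * w t) (Ioi 0) := fun w hw => by
      simpa [IntegrableOn] using hw.integrable_smul_left_of_hasCompactSupport hg.continuous hgc
    rw [← setIntegral_eq_integral_of_forall_compl_eq_zero (s := Ioi 0)
      fun t ht => by rw [hK.eq_zero (not_lt.1 ht), zero_smul]]
    simp only [Pi.sub_apply, Complex.real_smul, mul_sub]
    rw [integral_sub (hint u hu) (hint v hv), h g hK, sub_self]

lemma locallyIntegrable_L2Pos (u : L2Pos) : LocallyIntegrable u (volume.restrict (Ioi 0)) :=
  (Lp.memLp u).locallyIntegrable (by norm_num)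

lemma tendsto_neg_add_mul_I (w : ℝ) :
    Tendsto (fun r : ℝ => -(r : ℂ) + w * Complex.I) (𝓝[>] 0) (𝓝 (w * Complex.I)) := by
  have : Continuous fun r : ℝ => -(r : ℂ) + w * Complex.I := by fun_prop
  have h := this.tendsto 0
  rw [Complex.ofReal_zero, neg_zero, zero_add] at h
  exact h.mono_left nhdsWithin_le_nhds

/-! ### The kernel of a bounded holomorphic function -/

namespace HInfMinus

/-- The boundary function of `f(z) / (1 - z)`. -/
def symbol (f : HInfMinus) (ξ : ℝ) : ℂ :=
  boundaryValue f (2 * Real.pi * ξ) / (1 - (2 * Real.pi * ξ : ℝ) * Complex.I)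

lemma norm_sq_one_sub_mul_I (w : ℝ) : ‖(1 : ℂ) - w * Complex.I‖ ^ 2 = 1 + w ^ 2 := by
  rw [Complex.sq_norm, Complex.normSq_apply]
  simp
  ring

lemma one_sub_mul_I_ne_zero (w : ℝ) : (1 : ℂ) - w * Complex.I ≠ 0 := fun h => by
  simpa using congrArg Complex.re h

lemma memLp_symbol (f : HInfMinus) : MemLp f.symbol 2 := by
  have h0 : Measurable fun ξ : ℝ => boundaryValue f (2 * Real.pi * ξ) :=
    f.measurable_boundaryValue.comp (by fun_prop)
  have hm : AEStronglyMeasurable f.symbol volume := (h0.div (by fun_prop)).aestronglyMeasurable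
  obtain ⟨M, hM⟩ := f.exists_boundaryValue_bound
  rw [memLp_two_iff_integrable_sq_norm hm]
  refine ((integrable_const_div_one_add_sq (M ^ 2)).comp_mul_left'
    (R := 2 * Real.pi) (by positivity)).mono' (by fun_prop) (Eventually.of_forall fun ξ => ?_)
  rw [Real.norm_eq_abs, abs_of_nonneg (by positivity), symbol, norm_div, div_pow,
    norm_sq_one_sub_mul_I]
  gcongr
  exact hM _

/-- The function `h` in `L²(0,∞)`, extended by zero to the negative half-line, such that
`f(z) / (1 - z) = ∫₀^∞ h(s) e^{sz} ds`. -/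
def kernel (f : HInfMinus) : L2Line := Lp.fourierTransformₗᵢ ℝ ℂ f.memLp_symbol.toLp

open FourierTransform in
lemma integral_kernel_mul (f : HInfMinus) {v : ℝ → ℂ} (h1 : Integrable v) (h2 : MemLp v 2) :
    ∫ s, f.kernel s * v s = ∫ ξ, f.symbol ξ * 𝓕 v ξ := by
  have h := integral_fourier_mul_eq f.memLp_symbol.toLp h2.toLp
  have e1 : ∫ s, f.kernel s * v s
      = ∫ s, (𝓕 (f.memLp_symbol.toLp : L2Line) : L2Line) s * (h2.toLp : L2Line) s := by
    refine integral_congr_ae ?_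
    filter_upwards [h2.coeFn_toLp] with s hs
    rw [hs]
    rfl
  rw [e1, h]
  refine integral_congr_ae ?_
  filter_upwards [f.memLp_symbol.coeFn_toLp, fourier_toLp_ae_eq h1 h2] with ξ h3 h4
  rw [h3, h4]

/-- The contour is pushed to Re z = -r with r → ∞. There K̂(-z) f(z) keeps a fixed integrable
majorant, while 1/(1 - z) contributes 1/(1 + r). -/
lemma integral_testFun_mul_symbol (f : HInfMinus) {K : ℝ → ℝ} (hK : IsTestFun K) :
    ∫ ξ : ℝ, laplaceIntegral (fun t => (K t : ℂ)) (-((2 * Real.pi * ξ : ℝ) * Complex.I))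
      * f.symbol ξ = 0 := by
  obtain ⟨M, hM⟩ := f.bdd
  have hM0 : 0 ≤ M := (norm_nonneg _).trans (hM (-1) (by simp))
  obtain ⟨C, hC0, hC⟩ := hK.exists_laplaceIntegral_bound 0
  set H : ℂ → ℂ := fun z => laplaceIntegral (fun t => (K t : ℂ)) (-z) * (f z / (1 - z)) with hH
  have hre : ∀ z : ℂ, 1 - z.re ≤ ‖1 - z‖ := fun z => by
    simpa using Complex.re_le_norm (1 - z)
  have hHb : ∀ z : ℂ, z.re < 0 → ‖H z‖ ≤ C * M / (1 - z.re) / (1 + z.im ^ 2) := by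
    intro z hz
    have h1 := hC (-z) (by simpa using hz.le)
    rw [Complex.neg_im, neg_sq] at h1
    rw [hH, norm_mul, norm_div]
    calc _ ≤ (C / (1 + z.im ^ 2)) * (M / (1 - z.re)) := by
          gcongr
          · linarith
          · exact hM z hz
          · exact hre z
      _ = _ := by ring
  have hHd : DifferentiableOn ℂ H {z | z.re < 0} := by
    refine DifferentiableOn.mul ?_ (f.holo.div (by fun_prop) fun z hz h => ?_)
    · exact (hK.differentiable_laplaceIntegral.comp differentiable_neg).differentiableOn
    · have := hre z
      rw [h, norm_zero] at this
      have hz' : z.re < 0 := hz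
      linarith
  have hlim : Tendsto (fun r : ℝ => C * M / (1 + r) * ∫ ξ : ℝ, 1 / (1 + (2 * Real.pi * ξ) ^ 2))
      atTop (𝓝 0) := by
    have : Tendsto (fun r : ℝ => C * M / (1 + r)) atTop (𝓝 0) :=
      Tendsto.div_atTop tendsto_const_nhds (tendsto_atTop_add_const_left _ _ tendsto_id)
    have h := this.mul_const (∫ ξ : ℝ, 1 / (1 + (2 * Real.pi * ξ) ^ 2))
    rwa [zero_mul] at h
  refine norm_le_zero_iff.1 (ge_of_tendsto hlim ?_)
  filter_upwards [eventually_gt_atTop 0] with r hr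
  rw [integral_boundary_eq_integral_vertical (H := H) (R := r + 1) (C := C * M) (r := r)
    (hHd.mono fun z hz => hz.2) ?_ ?_ hr (by linarith), ← integral_const_mul]
  · refine norm_integral_le_of_norm_le ?_ (Eventually.of_forall fun ξ => ?_)
    · exact ((integrable_const_div_one_add_sq 1).comp_mul_left'
        (R := 2 * Real.pi) (by positivity)).const_mul _
    · refine (hHb _ (by simpa using hr)).trans (le_of_eq ?_)
      simp [div_eq_mul_inv]
  · intro z _ hz
    refine (hHb z hz).trans ?_
    gcongr
    exact div_le_self (by positivity) (by linarith)
  · filter_upwards [f.ae_hasBoundaryLimit_two_pi] with ξ hξ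
    have hz := tendsto_neg_add_mul_I (2 * Real.pi * ξ)
    refine Tendsto.mul ?_ (hξ.div (tendsto_const_nhds.sub hz) (one_sub_mul_I_ne_zero _))
    exact (hK.differentiable_laplaceIntegral.continuous.tendsto _).comp hz.neg

open FourierTransform in
/-- The Paley–Wiener theorem for `f(z) / (1 - z)`: its kernel is supported in `[0,∞)`. -/
theorem kernel_ae_eq_zero (f : HInfMinus) : ∀ᵐ s : ℝ, s < 0 → f.kernel s = 0 := by
  refine isOpen_Iio.ae_eq_zero_of_integral_contDiff_smul_eq_zero (U := Iio (0 : ℝ))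
    (((Lp.memLp _).locallyIntegrable (by norm_num)).locallyIntegrableOn _) ?_
  intro g hg hgc hgs
  have hK : IsTestFun fun t => g (-t) := by
    refine ⟨hg.comp contDiff_neg, hgc.comp_homeomorph (Homeomorph.neg ℝ), ?_⟩
    have : tsupport (fun t => g (-t)) = (Homeomorph.neg ℝ) ⁻¹' tsupport g :=
      tsupport_comp_eq_preimage g (Homeomorph.neg ℝ)
    rw [this]
    intro t ht
    have := hgs ht
    simpa using this
  have hgC : HasCompactSupport fun t => (g t : ℂ) := hgc.comp_left Complex.ofReal_zero
  have hgc' : Continuous fun t => (g t : ℂ) := Complex.continuous_ofReal.comp hg.continuous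
  have e1 : ∫ s, g s • f.kernel s = ∫ s, f.kernel s * g s := by
    simp only [Complex.real_smul, mul_comm]
  rw [e1, f.integral_kernel_mul (hgc'.integrable_of_hasCompactSupport hgC)
    (hgc'.memLp_of_hasCompactSupport hgC), ← f.integral_testFun_mul_symbol hK]
  refine integral_congr_ae (Eventually.of_forall fun ξ => ?_)
  simp only
  rw [mul_comm, hK.laplaceIntegral_eq, Real.fourier_real_eq_integral_exp_smul,
    ← integral_neg_eq_self]
  congr 1
  refine integral_congr_ae (Eventually.of_forall fun t => ?_)
  simp only [smul_eq_mul]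
  congr 2
  push_cast
  ring

end HInfMinus


/-! ### Toeplitz operators on exponentially decaying functions -/

lemma memLp_of_exp_bound {G : ℝ → ℂ} {c ω : ℝ} (hω : 0 < ω)
    (hm : AEStronglyMeasurable G (volume.restrict (Ioi 0)))
    (hG : ∀ t > 0, ‖G t‖ ≤ c * Real.exp (-ω * t)) : MemLp G 2 (volume.restrict (Ioi 0)) := by
  have hexp : MemLp (fun t : ℝ => Real.exp (-ω * t)) 2 (volume.restrict (Ioi 0)) := by
    rw [memLp_two_iff_integrable_sq (by fun_prop)]
    refine (exp_neg_integrableOn_Ioi 0 (b := 2 * ω) (by positivity)).congr_fun (fun t _ => ?_)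
      measurableSet_Ioi
    simp only
    rw [← Real.exp_nat_mul]
    congr 1
    push_cast
    ring
  refine hexp.of_le_mul (c := c) hm ?_
  filter_upwards [ae_restrict_mem measurableSet_Ioi] with t ht
  simpa using hG t ht

lemma integrableOn_of_exp_bound {G : ℝ → ℂ} {c ω : ℝ} (hω : 0 < ω)
    (hm : AEStronglyMeasurable G (volume.restrict (Ioi 0)))
    (hG : ∀ t > 0, ‖G t‖ ≤ c * Real.exp (-ω * t)) : IntegrableOn G (Ioi 0) := by
  have := integrableOn_exp_mul hm hG (z := 0) (by simpa using hω)
  simpa using this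

open FourierTransform in
lemma fourier_translate_indicator_Ioi (G : ℝ → ℂ) (t ξ : ℝ) :
    𝓕 (fun s => (Ioi (0 : ℝ)).indicator G (s + t)) ξ
      = Complex.exp ((2 * Real.pi * ξ : ℝ) * Complex.I * t)
        * laplaceIntegral G ((2 * Real.pi * ξ : ℝ) * Complex.I) := by
  rw [← fourier_indicator_Ioi, Real.fourier_real_eq_integral_exp_smul,
    Real.fourier_real_eq_integral_exp_smul, ← integral_const_mul,
    eq_comm, ← integral_add_right_eq_self (μ := volume) _ t, eq_comm]
  refine integral_congr_ae (Eventually.of_forall fun s => ?_)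
  simp only [smul_eq_mul]
  rw [← mul_assoc, ← Complex.exp_add]
  congr 2
  push_cast
  ring

/-- Multiplication by e^{iwt} translates G by t. Since the kernel lives on s ≥ 0 and t > 0, cutting
G off at 0 does not affect G(s + t). -/
lemma HInfMinus.integral_symbol_mul (f : HInfMinus) {G : ℝ → ℂ}
    (h1 : IntegrableOn G (Ioi 0)) (h2 : MemLp G 2 (volume.restrict (Ioi 0)))
    {t : ℝ} (ht : 0 < t) :
    ∫ ξ : ℝ, f.symbol ξ * (Complex.exp ((2 * Real.pi * ξ : ℝ) * Complex.I * t)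
        * laplaceIntegral G ((2 * Real.pi * ξ : ℝ) * Complex.I))
      = ∫ s in Ioi (0 : ℝ), f.kernel s * G (s + t) := by
  have h1' : Integrable fun s => (Ioi (0 : ℝ)).indicator G (s + t) :=
    ((integrable_indicator_iff measurableSet_Ioi).2 h1).comp_add_right t
  have h2' : MemLp (fun s => (Ioi (0 : ℝ)).indicator G (s + t)) 2 :=
    ((memLp_indicator_iff_restrict measurableSet_Ioi).2 h2).comp_measurePreserving
      (measurePreserving_add_right volume t)
  have h := f.integral_kernel_mul h1' h2'
  simp only [fourier_translate_indicator_Ioi] at h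
  rw [← h, ← integral_indicator measurableSet_Ioi]
  refine integral_congr_ae ?_
  filter_upwards [f.kernel_ae_eq_zero, Measure.ae_ne volume (0 : ℝ)] with s hs hs0
  rcases lt_or_gt_of_ne hs0 with h3 | h3
  · rw [hs h3, zero_mul, indicator_of_notMem (by simpa using h3.le)]
  · rw [indicator_of_mem (show s ∈ Ioi (0 : ℝ) from h3),
      indicator_of_mem (show s + t ∈ Ioi (0 : ℝ) from add_pos h3 ht)]

/-- The Toeplitz operator `M_f` acts on `F` as integration of `F - F'` against the kernel of `f`.
The relation between `F` and `G = F - F'` is expressed by Laplace integrals. -/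
theorem toeplitz_ae_eq_integral_kernel (f : HInfMinus) {F G P : ℝ → ℂ}
    (hF1 : IntegrableOn F (Ioi 0)) (hF2 : MemLp F 2 (volume.restrict (Ioi 0)))
    (hG1 : IntegrableOn G (Ioi 0)) (hG2 : MemLp G 2 (volume.restrict (Ioi 0))) (a : ℂ)
    (hFG : ∀ w : ℝ, (1 - w * Complex.I) * laplaceIntegral F (w * Complex.I)
      = laplaceIntegral G (w * Complex.I) - a)
    (hP : LocallyIntegrable P (volume.restrict (Ioi 0)))
    (hPe : ∀ t > 0, P t = ∫ s in Ioi (0 : ℝ), f.kernel s * G (s + t)) :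
    toeplitz f hF2.toLp =ᵐ[volume.restrict (Ioi 0)] P := by
  refine ae_eq_of_integral_testFun (locallyIntegrable_L2Pos _) hP fun K hK => ?_
  set k : ℝ → ℂ := fun ξ =>
    laplaceIntegral (fun t => (K t : ℂ)) (-((2 * Real.pi * ξ : ℝ) * Complex.I)) with hk
  set Ghat : ℝ → ℂ := fun ξ => laplaceIntegral G ((2 * Real.pi * ξ : ℝ) * Complex.I) with hGhat
  have hGhat2 : MemLp Ghat 2 := (Lp.memLp (laplace hG2.toLp)).ae_eq (laplace_toLp_ae_eq hG1 hG2)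
  have hsG : Integrable fun ξ => f.symbol ξ * Ghat ξ := f.memLp_symbol.integrable_mul hGhat2
  obtain ⟨C, hC0, hC⟩ := hK.exists_laplaceIntegral_bound 0
  have hkc : Continuous k := hK.differentiable_laplaceIntegral.continuous.comp (by fun_prop)
  have hkC : ∀ ξ, ‖k ξ‖ ≤ C / (1 + (2 * Real.pi * ξ) ^ 2) := fun ξ => by
    simpa [hk] using hC (-((2 * Real.pi * ξ : ℝ) * Complex.I)) (by simp)
  have hk2 : MemLp k 2 := by
    have := (Lp.memLp (laplace ((hK.memLp 2).restrict (Ioi 0)).toLp)).ae_eq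
      (laplace_toLp_ae_eq hK.integrable.integrableOn ((hK.memLp 2).restrict (Ioi 0)))
    refine (this.comp_measurePreserving (Measure.measurePreserving_neg volume)).ae_eq
      (Eventually.of_forall fun ξ => ?_)
    simp [hk]
  have hks : Integrable fun ξ => k ξ * f.symbol ξ := hk2.integrable_mul f.memLp_symbol
  have hksG : Integrable fun ξ => k ξ * (f.symbol ξ * Ghat ξ) := by
    refine hsG.bdd_mul (c := C) hkc.aestronglyMeasurable (Eventually.of_forall fun ξ => ?_)
    exact (hkC ξ).trans (div_le_self hC0 (by nlinarith [sq_nonneg (2 * Real.pi * ξ)]))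
  -- Writing F̂ = (Ĝ - a)/(1 - iw) splits off a multiple of the symbol alone, which
  -- `integral_testFun_mul_symbol` annihilates.
  have e1 : ∫ t in Ioi (0 : ℝ), (K t : ℂ) * toeplitz f hF2.toLp t
      = ∫ ξ, (k ξ * (f.symbol ξ * Ghat ξ) - a * (k ξ * f.symbol ξ)) := by
    rw [hK.integral_mul_toeplitz]
    refine integral_congr_ae ?_
    filter_upwards [laplace_toLp_ae_eq hF1 hF2] with ξ hξ
    rw [hξ]
    have h1 := hFG (2 * Real.pi * ξ)
    have h2 := HInfMinus.one_sub_mul_I_ne_zero (2 * Real.pi * ξ)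
    have h3 : boundaryValue f (2 * Real.pi * ξ)
        * laplaceIntegral F ((2 * Real.pi * ξ : ℝ) * Complex.I) = f.symbol ξ * (Ghat ξ - a) := by
      rw [hGhat]
      simp only
      rw [← h1, HInfMinus.symbol]
      field_simp
    rw [h3]
    ring
  have e2 : ∫ ξ, k ξ * (f.symbol ξ * Ghat ξ)
      = ∫ ξ : ℝ, ∫ t in Ioi (0 : ℝ), Complex.exp ((2 * Real.pi * ξ : ℝ) * Complex.I * t) *
        ((f.symbol ξ * Ghat ξ) * K t) := by
    refine integral_congr_ae (Eventually.of_forall fun ξ => ?_)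
    simp only [hk, laplaceIntegral]
    rw [← integral_mul_const]
    refine integral_congr_ae (Eventually.of_forall fun t => ?_)
    simp only
    rw [neg_mul, neg_neg]
    ring
  -- Fubini applies since symbol · Ĝ is a product of two L² functions, K is integrable and the
  -- exponential is unimodular.
  have hprod : Integrable (fun p : ℝ × ℝ =>
      Complex.exp ((2 * Real.pi * p.1 : ℝ) * Complex.I * p.2) *
        ((f.symbol p.1 * Ghat p.1) * K p.2)) (volume.prod (volume.restrict (Ioi 0))) := by
    refine (hsG.mul_prod hK.integrable.integrableOn).bdd_mul (c := 1)
      (by fun_prop) (Eventually.of_forall fun p => ?_)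
    rw [Complex.norm_exp]
    simp
  rw [e1, integral_sub hksG (hks.const_mul a), integral_const_mul, f.integral_testFun_mul_symbol hK,
    mul_zero, sub_zero, e2, integral_integral_swap hprod]
  refine setIntegral_congr_fun measurableSet_Ioi fun t ht => ?_
  rw [hPe t ht, ← f.integral_symbol_mul hG1 hG2 ht, ← integral_const_mul]
  refine integral_congr_ae (Eventually.of_forall fun ξ => ?_)
  simp only [hGhat]
  ring


/-- The Laplace integral of a derivative. -/
theorem laplaceIntegral_of_hasDerivWithinAt {F F' : ℝ → ℂ} {c c' ω : ℝ} (hF : Continuous F)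
    (hF' : Continuous F') (hd : ∀ t ≥ 0, HasDerivWithinAt F (F' t) (Ioi t) t)
    (hb : ∀ t > 0, ‖F t‖ ≤ c * Real.exp (-ω * t))
    (hb' : ∀ t > 0, ‖F' t‖ ≤ c' * Real.exp (-ω * t)) {z : ℂ} (hz : -ω < z.re) :
    laplaceIntegral F' z = z * laplaceIntegral F z - F 0 := by
  have hi := integrableOn_exp_mul hF.aestronglyMeasurable hb hz
  have hi' := integrableOn_exp_mul hF'.aestronglyMeasurable hb' hz
  have hexp : ∀ t : ℝ, HasDerivAt (fun t : ℝ => Complex.exp (-(z * t)))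
      (Complex.exp (-(z * t)) * -z) t := fun t => by
    have h := ((Complex.ofRealCLM.hasDerivAt (x := t)).const_mul z).neg
    rw [Complex.ofRealCLM_apply, Complex.ofReal_one, mul_one] at h
    exact h.cexp
  set g : ℝ → ℂ := fun t => Complex.exp (-(z * t)) * -z * F t + Complex.exp (-(z * t)) * F' t
    with hg
  have hgc : Continuous g := by fun_prop
  have hgi : IntegrableOn g (Ioi 0) := by
    refine ((hi.const_mul (-z)).add hi').congr (Eventually.of_forall fun t => ?_)
    simp only [hg, Pi.add_apply]
    ring
  have h1 : ∀ t ≥ 0, ∫ s in (0 : ℝ)..t, g s = Complex.exp (-(z * t)) * F t - F 0 := by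
    intro t ht
    rw [intervalIntegral.integral_eq_sub_of_hasDeriv_right
      (f := fun t : ℝ => Complex.exp (-(z * t)) * F t) (f' := g) (by fun_prop) (fun s hs => ?_)
      (hgc.intervalIntegrable _ _)]
    · simp
    · rw [min_eq_left ht] at hs
      exact (hexp s).hasDerivWithinAt.mul (hd s hs.1.le)
  have h2 : Tendsto (fun t : ℝ => Complex.exp (-(z * t)) * F t) atTop (𝓝 0) := by
    refine squeeze_zero_norm' (a := fun t => c * Real.exp (-(z.re + ω) * t)) ?_ ?_
    · filter_upwards [eventually_gt_atTop 0] with t ht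
      exact norm_exp_mul_le (hb t ht) z
    · have h3 : Tendsto (fun t : ℝ => Real.exp (-(z.re + ω) * t)) atTop (𝓝 0) :=
        Real.tendsto_exp_atBot.comp
          (tendsto_id.const_mul_atTop_of_neg (by linarith))
      simpa using h3.const_mul c
  have h3 := intervalIntegral_tendsto_integral_Ioi 0 hgi tendsto_id
  have h4 : ∫ t in Ioi (0 : ℝ), g t = 0 - F 0 := by
    refine tendsto_nhds_unique h3 ((h2.sub_const (F 0)).congr' ?_)
    filter_upwards [eventually_ge_atTop 0] with t ht
    exact (h1 t ht).symm
  have h5 : ∫ t in Ioi (0 : ℝ), g t = -z * laplaceIntegral F z + laplaceIntegral F' z := by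
    rw [laplaceIntegral, laplaceIntegral, ← integral_const_mul, ← integral_add (hi.const_mul _) hi']
    refine integral_congr_ae (Eventually.of_forall fun t => ?_)
    simp only [hg]
    ring
  linear_combination h5.symm.trans h4

namespace C0Semigroup

variable {X : Type*} [NormedAddCommGroup X] [NormedSpace ℂ X]

/-! ### Generators -/

lemma generator_tendsto (T : C0Semigroup X) (x : T.generator.domain) :
    Tendsto (fun t : ℝ≥0 => (((t : ℝ) : ℂ)⁻¹) • (T t (x : X) - x)) (𝓝[>] 0)
      (𝓝 (T.generator x)) := by
  have h := limitOp_spec (𝓝[>] (0 : ℝ≥0)) (fun t =>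
    (((t : ℝ) : ℂ)⁻¹) • ((T t : X →ₗ[ℂ] X) - LinearMap.id)) x
  simp only [LinearMap.smul_apply, LinearMap.sub_apply, LinearMap.id_apply] at h
  exact h

lemma mem_domain_of_tendsto (T : C0Semigroup X) {x z : X}
    (h : Tendsto (fun t : ℝ≥0 => (((t : ℝ) : ℂ)⁻¹) • (T t x - x)) (𝓝[>] 0) (𝓝 z)) :
    x ∈ T.generator.domain :=
  ⟨z, by simpa using h⟩

lemma generator_eq_of_tendsto (T : C0Semigroup X) {x : T.generator.domain} {z : X}
    (h : Tendsto (fun t : ℝ≥0 => (((t : ℝ) : ℂ)⁻¹) • (T t (x : X) - x)) (𝓝[>] 0) (𝓝 z)) :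
    T.generator x = z :=
  tendsto_nhds_unique (T.generator_tendsto x) h

lemma map_add_apply (T : C0Semigroup X) (s t : ℝ≥0) (x : X) : T (s + t) x = T s (T t x) := by
  rw [T.map_add', ContinuousLinearMap.comp_apply]

lemma map_comm (T : C0Semigroup X) (s t : ℝ≥0) (x : X) : T s (T t x) = T t (T s x) := by
  rw [← map_add_apply, add_comm, map_add_apply]

lemma generator_map (T : C0Semigroup X) (t : ℝ≥0) (x : T.generator.domain) :
    T.generator ⟨T t x, T.map_mem_domain t x.2⟩ = T t (T.generator x) := by
  refine T.generator_eq_of_tendsto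
    ((((T t).continuous.tendsto _).comp (T.generator_tendsto x)).congr fun s => ?_)
  simp only [Function.comp_apply, map_smul, map_sub]
  rw [T.map_comm]

/-- Only the right derivative comes directly from the generator; it suffices for
`laplaceIntegral_of_hasDerivWithinAt`. -/
lemma hasDerivWithinAt_orbit (T : C0Semigroup X) (x : T.generator.domain) (y : StrongDual ℂ X)
    {t : ℝ} (ht : 0 ≤ t) :
    HasDerivWithinAt (fun t : ℝ => y (T t.toNNReal (x : X)))
      (y (T t.toNNReal (T.generator x))) (Ioi t) t := by
  rw [hasDerivWithinAt_iff_tendsto_slope, sdiff_singleton_eq_self (by simp)]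
  have hu : Tendsto (fun s : ℝ => (s - t).toNNReal) (𝓝[>] t) (𝓝[>] 0) := by
    refine tendsto_nhdsWithin_iff.2 ⟨?_, ?_⟩
    · have : Continuous fun s : ℝ => (s - t).toNNReal := by fun_prop
      have h := this.tendsto t
      rw [sub_self, Real.toNNReal_zero] at h
      exact h.mono_left nhdsWithin_le_nhds
    · filter_upwards [self_mem_nhdsWithin] with s hs
      simpa using hs
  have h := ((y.comp (T t.toNNReal)).continuous.tendsto _).comp ((T.generator_tendsto x).comp hu)
  refine h.congr' ?_
  filter_upwards [self_mem_nhdsWithin] with s hs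
  have hs0 : 0 ≤ s - t := sub_nonneg.2 (le_of_lt hs)
  have hst : s.toNNReal = t.toNNReal + (s - t).toNNReal := by
    rw [← Real.toNNReal_add ht hs0, add_sub_cancel]
  simp only [Function.comp_apply, map_smul, map_sub, ContinuousLinearMap.comp_apply, slope_def_module]
  rw [Real.coe_toNNReal _ hs0, hst, map_add_apply, ← Complex.ofReal_inv, Complex.coe_smul]

lemma continuous_orbit (T : C0Semigroup X) (x : X) : Continuous fun t : ℝ => T t.toNNReal x :=
  (T.continuous' x).comp continuous_real_toNNReal

lemma norm_apply_le {T : C0Semigroup X} {M ω : ℝ}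
    (hM : ∀ t : ℝ≥0, ‖T t‖ ≤ M * Real.exp (-ω * t)) (x : X) {t : ℝ} (ht : 0 < t) :
    ‖T t.toNNReal x‖ ≤ M * ‖x‖ * Real.exp (-ω * t) := by
  have h := hM t.toNNReal
  rw [Real.coe_toNNReal _ ht.le] at h
  calc _ ≤ ‖T t.toNNReal‖ * ‖x‖ := (T t.toNNReal).le_opNorm x
    _ ≤ M * Real.exp (-ω * t) * ‖x‖ := by gcongr
    _ = _ := by ring

lemma norm_orbit_le {T : C0Semigroup X} {M ω : ℝ}
    (hM : ∀ t : ℝ≥0, ‖T t‖ ≤ M * Real.exp (-ω * t)) (x : X) (y : StrongDual ℂ X) :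
    ∀ t > 0, ‖y (T t.toNNReal x)‖ ≤ ‖y‖ * (M * ‖x‖) * Real.exp (-ω * t) := fun t ht => by
  rw [mul_assoc]
  exact (y.le_opNorm _).trans (by gcongr; exact norm_apply_le hM x ht)

/-! ### Existence of `f(A)` -/

section Existence

variable {T : C0Semigroup X}

/-- The kernel is only square integrable; its product with the decaying exponential is integrable by
Cauchy–Schwarz. -/
lemma exists_kernel_smul_bound (hT : T.ExpStable) (f : HInfMinus) :
    ∃ b : ℝ → ℝ, IntegrableOn b (Ioi 0) ∧ ∀ x : X, ∀ᵐ s : ℝ ∂volume.restrict (Ioi 0),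
      ‖f.kernel s • T s.toNNReal x‖ ≤ b s * ‖x‖ := by
  obtain ⟨M, ω, hω, hM⟩ := hT
  have hexp : MemLp (fun s : ℝ => ((M * Real.exp (-ω * s) : ℝ) : ℂ)) 2
      (volume.restrict (Ioi 0)) := by
    refine memLp_of_exp_bound (c := |M|) hω (by fun_prop) fun t _ => ?_
    rw [Complex.norm_real, norm_mul, Real.norm_eq_abs, Real.norm_eq_abs, Real.abs_exp]
  have hint : Integrable (fun s => f.kernel s * ((M * Real.exp (-ω * s) : ℝ) : ℂ))
      (volume.restrict (Ioi 0)) := ((Lp.memLp f.kernel).restrict _).integrable_mul hexp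
  refine ⟨_, hint.norm, fun x => ?_⟩
  filter_upwards [ae_restrict_mem measurableSet_Ioi] with s hs
  rw [norm_smul, norm_mul, mul_assoc]
  gcongr
  refine (norm_apply_le hM x hs).trans ?_
  rw [Complex.norm_real, Real.norm_eq_abs]
  calc _ = M * Real.exp (-ω * s) * ‖x‖ := by ring
    _ ≤ _ := by
      gcongr
      exact le_abs_self _

lemma integrableOn_kernel_smul (hT : T.ExpStable) (f : HInfMinus) (x : X) :
    IntegrableOn (fun s : ℝ => f.kernel s • T s.toNNReal x) (Ioi 0) := by
  obtain ⟨b, hb, hbx⟩ := exists_kernel_smul_bound hT f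
  exact (hb.mul_const ‖x‖).mono' ((Lp.aestronglyMeasurable _).restrict.smul
    (T.continuous_orbit x).aestronglyMeasurable) (hbx x)

/-- The bounded operator `x ↦ ∫₀^∞ h(s) T(s) x ds`, where `h` is the kernel of `f`. -/
def kernelOp (hT : T.ExpStable) (f : HInfMinus) : X →L[ℂ] X :=
  LinearMap.mkContinuousOfExistsBound
    { toFun := fun x => ∫ s in Ioi (0 : ℝ), f.kernel s • T s.toNNReal x
      map_add' := fun x y => by
        rw [← integral_add (integrableOn_kernel_smul hT f x) (integrableOn_kernel_smul hT f y)]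
        simp
      map_smul' := fun c x => by
        rw [RingHom.id_apply, ← integral_smul]
        simp [smul_comm c] } <| by
    obtain ⟨b, hb, hbx⟩ := exists_kernel_smul_bound hT f
    refine ⟨∫ s in Ioi (0 : ℝ), b s, fun x => ?_⟩
    rw [← integral_mul_const]
    exact norm_integral_le_of_norm_le (hb.mul_const ‖x‖) (hbx x)

lemma kernelOp_apply (hT : T.ExpStable) (f : HInfMinus) (x : X) :
    kernelOp hT f x = ∫ s in Ioi (0 : ℝ), f.kernel s • T s.toNNReal x := rfl

/-- Since f(z) = (1 - z) ∫ h(s) e^{sz} ds, substituting A for z suggests this formula. -/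
theorem isHInfOp_kernelOp [CompleteSpace X] (hT : T.ExpStable) (f : HInfMinus) :
    IsHInfOp hT f ((kernelOp hT f : X →ₗ[ℂ] X).comp
      (T.generator.domain.subtype - T.generator.toFun)) where
  bounded := by
    refine ⟨‖kernelOp hT f‖, fun x => ?_⟩
    refine ((kernelOp hT f).le_opNorm _).trans ?_
    gcongr
    exact norm_sub_le _ _
  toeplitz_eq y x := by
    obtain ⟨M, ω, hω, hM⟩ := id hT
    set w : X := x - T.generator x with hw
    have hcy : ∀ x : X, Continuous fun t : ℝ => y (T t.toNNReal x) := fun x =>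
      y.continuous.comp (T.continuous_orbit x)
    have hP : ∀ t : ℝ, y (((kernelOp hT f : X →ₗ[ℂ] X).comp
        (T.generator.domain.subtype - T.generator.toFun))
          ⟨T t.toNNReal x, T.map_mem_domain _ x.2⟩) = y (kernelOp hT f (T t.toNNReal w)) := by
      intro t
      have h : (T.generator.domain.subtype - T.generator.toFun)
          ⟨T t.toNNReal x, T.map_mem_domain _ x.2⟩ = T t.toNNReal w := by
        rw [hw, map_sub, ← T.generator_map]
        rfl
      rw [LinearMap.comp_apply, h]
      rfl
    simp only [hP]
    have hm := fun x : X => (hcy x).aestronglyMeasurable (μ := volume.restrict (Ioi (0 : ℝ)))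
    -- Here G = F - F', and the constant a is F(0) = ⟨y, x⟩, the boundary term in the Laplace
    -- transform of F'.
    refine toeplitz_ae_eq_integral_kernel f (F := fun t => y (T t.toNNReal (x : X)))
      (G := fun t => y (T t.toNNReal w)) (P := fun t => y (kernelOp hT f (T t.toNNReal w)))
      (integrableOn_of_exp_bound hω (hm _) (norm_orbit_le hM _ y)) (memLp_orbit hT (x : X) y)
      (integrableOn_of_exp_bound hω (hm _) (norm_orbit_le hM _ y)) (memLp_orbit hT w y)
      (y x) (fun u => ?_) ?_ (fun t ht => ?_)
    · have hre : -ω < ((u : ℂ) * Complex.I).re := by simpa using hω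
      have h1 := laplaceIntegral_of_hasDerivWithinAt (hcy x) (hcy (T.generator x))
        (fun t ht => T.hasDerivWithinAt_orbit x y ht) (norm_orbit_le hM _ y)
        (norm_orbit_le hM _ y) hre
      have h2 : laplaceIntegral (fun t => y (T t.toNNReal w)) (u * Complex.I)
          = laplaceIntegral (fun t => y (T t.toNNReal (x : X))) (u * Complex.I)
            - laplaceIntegral (fun t => y (T t.toNNReal (T.generator x))) (u * Complex.I) := by
        rw [laplaceIntegral, laplaceIntegral, laplaceIntegral,
          ← integral_sub (integrableOn_exp_mul (hm _) (norm_orbit_le hM _ y) hre)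
            (integrableOn_exp_mul (hm _) (norm_orbit_le hM _ y) hre)]
        simp only [hw, map_sub, mul_sub]
      simp only [Real.toNNReal_zero, T.map_zero', one_apply_eq_self] at h1
      rw [h2, h1]
      ring
    · exact Continuous.locallyIntegrable
        (y.continuous.comp ((kernelOp hT f).continuous.comp (T.continuous_orbit w)))
    · rw [kernelOp_apply, ← y.integral_comp_comm (integrableOn_kernel_smul hT f _)]
      refine setIntegral_congr_fun measurableSet_Ioi fun s hs => ?_
      simp only [map_smul, smul_eq_mul]
      rw [← map_add_apply, Real.toNNReal_add (le_of_lt hs) ht.le]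

end Existence

/-! ### Uniqueness of `f(A)` -/

/-- Orbits of points of D(A) are continuous in the graph norm, because A T(t)x = T(t)Ax. -/
lemma continuous_comp_orbit {T : C0Semigroup X} {C : T.generator.domain →ₗ[ℂ] X} {c : ℝ}
    (hC : ∀ x : T.generator.domain, ‖C x‖ ≤ c * (‖(x : X)‖ + ‖T.generator x‖))
    (x : T.generator.domain) :
    Continuous fun t : ℝ => C ⟨T t.toNNReal x, T.map_mem_domain _ x.2⟩ := by
  refine continuous_iff_continuousAt.2 fun t => tendsto_iff_norm_sub_tendsto_zero.2 ?_
  have h1 : Tendsto (fun s : ℝ => c * (‖T s.toNNReal (x : X) - T t.toNNReal x‖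
      + ‖T s.toNNReal (T.generator x) - T t.toNNReal (T.generator x)‖)) (𝓝 t) (𝓝 0) := by
    have := T.continuous_orbit x
    have := T.continuous_orbit (T.generator x)
    have h : Continuous fun s : ℝ => c * (‖T s.toNNReal (x : X) - T t.toNNReal x‖
      + ‖T s.toNNReal (T.generator x) - T t.toNNReal (T.generator x)‖) := by fun_prop
    simpa using h.tendsto t
  refine squeeze_zero (fun _ => norm_nonneg _) (fun s => ?_) h1
  rw [← map_sub]
  refine (hC _).trans (le_of_eq ?_)
  rw [LinearPMap.map_sub, T.generator_map, T.generator_map]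
  rfl

/-- Two continuous functions on [0,∞) that agree almost everywhere agree at t = 0, where T(0)x = x;
functionals separate points. -/
theorem IsHInfOp.eq {T : C0Semigroup X} {hT : T.ExpStable} {f : HInfMinus}
    {C₁ C₂ : T.generator.domain →ₗ[ℂ] X} (h₁ : IsHInfOp hT f C₁) (h₂ : IsHInfOp hT f C₂) :
    C₁ = C₂ := by
  ext x
  refine (SeparatingDual.eq_iff_forall_dual_eq (R := ℂ)).2 fun y => ?_
  obtain ⟨c₁, hc₁⟩ := h₁.bounded
  obtain ⟨c₂, hc₂⟩ := h₂.bounded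
  have h := (h₁.toeplitz_eq y x).symm.trans (h₂.toeplitz_eq y x)
  rw [Measure.restrict_congr_set Ioi_ae_eq_Ici] at h
  have h0 := Measure.eqOn_of_ae_eq h (y.continuous.comp (continuous_comp_orbit hc₁ x)).continuousOn
    (y.continuous.comp (continuous_comp_orbit hc₂ x)).continuousOn
    (by rw [interior_Ici, closure_Ioi]) self_mem_Ici
  simpa [T.map_zero'] using h0

theorem existsUnique_isHInfOp [CompleteSpace X] {T : C0Semigroup X} (hT : T.ExpStable)
    (f : HInfMinus) : ∃! C, IsHInfOp hT f C :=
  ⟨_, isHInfOp_kernelOp hT f, fun _ h => h.eq (isHInfOp_kernelOp hT f)⟩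

lemma isHInfOp_hInfOp [CompleteSpace X] {T : C0Semigroup X} (hT : T.ExpStable) (f : HInfMinus) :
    IsHInfOp hT f (hInfOp hT f) := by
  have h := (existsUnique_isHInfOp hT f).exists
  rw [hInfOp, dif_pos h]
  exact h.choose_spec

end C0Semigroup


/-! ### Toeplitz operators and exponential weights -/

lemma HInfMinus.continuousAt (f : HInfMinus) {z : ℂ} (hz : z.re < 0) : ContinuousAt f z :=
  (f.holo.differentiableAt
    ((isOpen_lt Complex.continuous_re continuous_const).mem_nhds hz)).continuousAt

/-- The shifted axis lies inside the half-plane, so the limit exists at every w by continuity. -/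
lemma HInfMinus.boundaryValue_shift (f : HInfMinus) {ε : ℝ} (hε : 0 < ε) (w : ℝ) :
    boundaryValue (f.shift ε hε.le) w = f (-(ε : ℂ) + w * Complex.I) := by
  refine HasBoundaryLimit.boundaryValue_eq ?_
  have h1 := f.continuousAt (z := -(ε : ℂ) + w * Complex.I) (by simpa using hε)
  have h2 := (tendsto_neg_add_mul_I w).sub_const (ε : ℂ)
  rw [← neg_add_eq_sub] at h2
  exact h1.tendsto.comp h2

lemma laplaceIntegral_exp_mul (F : ℝ → ℂ) (ε : ℝ) (z : ℂ) :
    laplaceIntegral (fun t => (Real.exp (ε * t) : ℂ) * F t) z = laplaceIntegral F (z - ε) := by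
  refine integral_congr_ae (Eventually.of_forall fun t => ?_)
  simp only
  rw [← mul_assoc, Complex.ofReal_exp, ← Complex.exp_add]
  congr 2
  push_cast
  ring

theorem toeplitz_shift_ae_eq (f : HInfMinus) {F : ℝ → ℂ} {c ω ε : ℝ} (hε : 0 < ε) (hω : 0 < ω)
    (hm : AEStronglyMeasurable F (volume.restrict (Ioi 0)))
    (hF : ∀ t > 0, ‖F t‖ ≤ c * Real.exp (-(ω + ε) * t))
    (h2 : MemLp F 2 (volume.restrict (Ioi 0)))
    (h2' : MemLp (fun t => (Real.exp (ε * t) : ℂ) * F t) 2 (volume.restrict (Ioi 0))) :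
    toeplitz (f.shift ε hε.le) h2'.toLp =ᵐ[volume.restrict (Ioi 0)]
      fun t => (Real.exp (ε * t) : ℂ) * toeplitz f h2.toLp t := by
  have hm' : AEStronglyMeasurable (fun t => (Real.exp (ε * t) : ℂ) * F t)
      (volume.restrict (Ioi 0)) :=
    (by fun_prop : Continuous fun t : ℝ => (Real.exp (ε * t) : ℂ)).aestronglyMeasurable.mul hm
  have hF' : ∀ t > 0, ‖(Real.exp (ε * t) : ℂ) * F t‖ ≤ c * Real.exp (-ω * t) := fun t ht => by
    rw [norm_mul, Complex.norm_real, Real.norm_eq_abs, Real.abs_exp]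
    calc _ ≤ Real.exp (ε * t) * (c * Real.exp (-(ω + ε) * t)) := by gcongr; exact hF t ht
      _ = c * (Real.exp (ε * t) * Real.exp (-(ω + ε) * t)) := by ring
      _ = _ := by
        rw [← Real.exp_add]
        ring_nf
  have hloc : LocallyIntegrable (fun t => (Real.exp (ε * t) : ℂ) * toeplitz f h2.toLp t)
      (volume.restrict (Ioi 0)) := by
    rw [← locallyIntegrableOn_univ]
    exact (locallyIntegrable_L2Pos _).locallyIntegrableOn univ |>.continuousOn_mul
      (by fun_prop : Continuous fun t : ℝ => (Real.exp (ε * t) : ℂ)).continuousOn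
      isOpen_univ.isLocallyClosed
  refine ae_eq_of_integral_testFun (locallyIntegrable_L2Pos _) hloc fun K hK => ?_
  obtain ⟨C, hC0, hC⟩ := hK.exists_laplaceIntegral_bound (-ε)
  obtain ⟨M, hM⟩ := f.bdd
  -- F̂ is holomorphic for Re z > -(ω + ε); stopping at -(ε + ω/2) gives a uniform bound and still
  -- leaves Re z = -ε inside the strip.
  set N : ℝ := ∫ t in Ioi (0 : ℝ), c * Real.exp (-(-(ε + ω / 2) + (ω + ε)) * t) with hN
  have hNb : ∀ z : ℂ, -(ε + ω / 2) < z.re → ‖laplaceIntegral F z‖ ≤ N := fun z hz =>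
    norm_laplaceIntegral_le (by linarith) hF hz.le
  set H : ℂ → ℂ := fun z =>
    laplaceIntegral (fun t => (K t : ℂ)) (-z - ε) * (f z * laplaceIntegral F z) with hH
  have hFd : ∀ z : ℂ, -(ε + ω / 2) < z.re → DifferentiableAt ℂ (laplaceIntegral F) z := fun z hz =>
    differentiableAt_laplaceIntegral hm hF (by linarith)
  have e1 : ∫ t in Ioi (0 : ℝ), (K t : ℂ) * toeplitz (f.shift ε hε.le) h2'.toLp t
      = ∫ ξ : ℝ, H (-(ε : ℂ) + (2 * Real.pi * ξ : ℝ) * Complex.I) := by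
    rw [hK.integral_mul_toeplitz]
    refine integral_congr_ae ?_
    filter_upwards [laplace_toLp_ae_eq (integrableOn_of_exp_bound hω hm' hF') h2'] with ξ hξ
    rw [hξ, laplaceIntegral_exp_mul, f.boundaryValue_shift hε]
    simp only [hH]
    congr 3 <;> ring
  have e2 : ∫ t in Ioi (0 : ℝ), (K t : ℂ) * ((Real.exp (ε * t) : ℂ) * toeplitz f h2.toLp t)
      = ∫ ξ : ℝ, laplaceIntegral (fun t => (K t : ℂ))
          (-((2 * Real.pi * ξ : ℝ) * Complex.I) - ε)
        * (boundaryValue f (2 * Real.pi * ξ)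
          * laplaceIntegral F ((2 * Real.pi * ξ : ℝ) * Complex.I)) := by
    have h := (hK.exp_mul ε).integral_mul_toeplitz f h2.toLp
    simp only [Complex.ofReal_mul] at h
    simp only [laplaceIntegral_exp_mul] at h
    have e3 : ∫ t in Ioi (0 : ℝ), (K t : ℂ) * ((Real.exp (ε * t) : ℂ) * toeplitz f h2.toLp t)
        = ∫ t in Ioi (0 : ℝ), (Real.exp (ε * t) : ℂ) * (K t : ℂ) * toeplitz f h2.toLp t := by
      congr 1
      ext t
      ring
    rw [e3, h]
    refine integral_congr_ae ?_
    filter_upwards [laplace_toLp_ae_eq (integrableOn_of_exp_bound (by linarith) hm hF) h2] with ξ hξ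
    rw [hξ]
    push_cast
    rfl
  rw [e1, e2]
  refine (integral_boundary_eq_integral_vertical (H := H) (R := ε + ω / 2) (C := C * (M * N))
    ?_ ?_ ?_ hε (by linarith)).symm
  · refine DifferentiableOn.mul ?_ ((f.holo.mono fun z hz => hz.2).mul fun z hz => ?_)
    · exact (hK.differentiable_laplaceIntegral.comp (by fun_prop)).differentiableOn
    · exact (hFd z hz.1).differentiableWithinAt
  · intro z hz1 hz2
    have h1 := hC (-z - ε) (by simp; linarith)
    have h3 : (-z - (ε : ℂ)).im ^ 2 = z.im ^ 2 := by simp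
    rw [h3] at h1
    have hM0 : 0 ≤ M := (norm_nonneg _).trans (hM z hz2)
    simp only [hH, norm_mul]
    calc _ ≤ C / (1 + z.im ^ 2) * (M * N) := by
          gcongr
          · exact hM z hz2
          · exact hNb z hz1
      _ = _ := by ring
  · filter_upwards [f.ae_hasBoundaryLimit_two_pi] with ξ hξ
    have hz := tendsto_neg_add_mul_I (2 * Real.pi * ξ)
    refine Tendsto.mul ?_ (hξ.mul ?_)
    · exact (hK.differentiable_laplaceIntegral.continuous.tendsto _).comp (hz.neg.sub_const _)
    · exact (hFd _ (by simp; linarith)).continuousAt.tendsto.comp hz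

namespace C0Semigroup

variable {X : Type*} [NormedAddCommGroup X] [NormedSpace ℂ X]

/-! ### Rescaled semigroups -/

lemma rescale_apply (T : C0Semigroup X) (ε : ℝ) (t : ℝ≥0) (x : X) :
    T.rescale ε t x = ((Real.exp (ε * t) : ℝ) : ℂ) • T t x := rfl

lemma tendsto_rescale (T : C0Semigroup X) (ε : ℝ) {x z : X}
    (h : Tendsto (fun t : ℝ≥0 => (((t : ℝ) : ℂ)⁻¹) • (T t x - x)) (𝓝[>] 0) (𝓝 z)) :
    Tendsto (fun t : ℝ≥0 => (((t : ℝ) : ℂ)⁻¹) • (T.rescale ε t x - x)) (𝓝[>] 0)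
      (𝓝 (z + (ε : ℂ) • x)) := by
  have hd : HasDerivAt (fun t : ℝ => Real.exp (ε * t)) ε 0 := by
    simpa using ((hasDerivAt_id (0 : ℝ)).const_mul ε).exp
  have hc : Tendsto (fun t : ℝ≥0 => (t : ℝ)) (𝓝[>] 0) (𝓝[≠] 0) := by
    refine tendsto_nhdsWithin_iff.2 ⟨?_, ?_⟩
    · have h := NNReal.continuous_coe.tendsto 0
      exact h.mono_left nhdsWithin_le_nhds
    · filter_upwards [self_mem_nhdsWithin] with t ht
      have ht' : (0 : ℝ≥0) < t := ht
      simpa using ht'.ne'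
  have h1 := (hasDerivAt_iff_tendsto_slope.1 hd).comp hc
  have h2 : Tendsto (fun t : ℝ≥0 => Real.exp (ε * t)) (𝓝[>] 0) (𝓝 1) := by
    have h := hd.continuousAt.tendsto.comp (hc.mono_right nhdsWithin_le_nhds)
    simpa [Function.comp_def] using h
  have h3 := (((Complex.continuous_ofReal.tendsto _).comp h2).smul h).add
    (((Complex.continuous_ofReal.tendsto _).comp h1).smul_const x)
  rw [Complex.ofReal_one, one_smul] at h3
  refine h3.congr fun t => ?_
  simp only [Function.comp_apply, rescale_apply, slope_def_field, mul_zero, Real.exp_zero, sub_zero,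
    Complex.ofReal_div, Complex.ofReal_sub, Complex.ofReal_one]
  module

lemma rescale_rescale_neg (T : C0Semigroup X) (ε : ℝ) (t : ℝ≥0) (x : X) :
    (T.rescale ε).rescale (-ε) t x = T t x := by
  rw [rescale_apply, rescale_apply, smul_smul, ← Complex.ofReal_mul, ← Real.exp_add]
  simp

/-- One inclusion is the product rule `tendsto_rescale`; the other is the same rule after rescaling
back by -ε. -/
lemma mem_domain_rescale_iff (T : C0Semigroup X) (ε : ℝ) {x : X} :
    x ∈ (T.rescale ε).generator.domain ↔ x ∈ T.generator.domain := by
  constructor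
  · intro hx
    have h := (T.rescale ε).tendsto_rescale (-ε) ((T.rescale ε).generator_tendsto ⟨x, hx⟩)
    simp only [rescale_rescale_neg] at h
    exact T.mem_domain_of_tendsto h
  · intro hx
    exact (T.rescale ε).mem_domain_of_tendsto (T.tendsto_rescale ε (T.generator_tendsto ⟨x, hx⟩))

/-- The domains of the generators of a semigroup and of a rescaled semigroup are the same. -/
def domainEquiv (T : C0Semigroup X) (ε : ℝ) :
    (T.rescale ε).generator.domain ≃ₗ[ℂ] T.generator.domain :=
  LinearEquiv.ofEq _ _ (Submodule.ext fun _ => T.mem_domain_rescale_iff ε)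

@[simp]
lemma coe_domainEquiv (T : C0Semigroup X) (ε : ℝ) (x : (T.rescale ε).generator.domain) :
    (T.domainEquiv ε x : X) = x := rfl

lemma generator_rescale_apply (T : C0Semigroup X) (ε : ℝ) (x : (T.rescale ε).generator.domain) :
    (T.rescale ε).generator x = T.generator (T.domainEquiv ε x) + (ε : ℂ) • (x : X) :=
  (T.rescale ε).generator_eq_of_tendsto
    (T.tendsto_rescale ε (T.generator_tendsto (T.domainEquiv ε x)))

theorem generator_rescale (T : C0Semigroup X) (ε : ℝ) :
    (T.rescale ε).generator
      = T.generator + ((ε : ℂ) • (LinearMap.id : X →ₗ[ℂ] X)).toPMap ⊤ := by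
  refine LinearPMap.ext ?_ fun x hx hx' => ?_
  · rw [LinearPMap.add_domain, LinearMap.toPMap_domain, inf_top_eq]
    exact Submodule.ext fun _ => T.mem_domain_rescale_iff ε
  · rw [generator_rescale_apply, LinearPMap.add_apply]
    rfl

/-- μ - (A + ε) and (μ - ε) - A are the same operator, hence bijective together; otherwise both
resolvents take the default value 0. -/
lemma resolvent_rescale (T : C0Semigroup X) (ε : ℝ) (μ : ℂ) (x : X) :
    T.domainEquiv ε ((T.rescale ε).resolvent μ x) = T.resolvent (μ - ε) x := by
  set S := (μ - ε) • T.generator.domain.subtype - T.generator.toFun with hS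
  set S' := μ • (T.rescale ε).generator.domain.subtype - (T.rescale ε).generator.toFun with hS'
  have hSS : ∀ v, S' v = S (T.domainEquiv ε v) := fun v => by
    change μ • (v : X) - (T.rescale ε).generator v
      = (μ - ε) • ((T.domainEquiv ε v : T.generator.domain) : X) - T.generator (T.domainEquiv ε v)
    rw [generator_rescale_apply, coe_domainEquiv]
    module
  have hbij : Function.Bijective S' ↔ Function.Bijective S := by
    rw [← Function.Bijective.of_comp_iff S (T.domainEquiv ε).bijective]
    exact iff_of_eq (congrArg _ (funext hSS))
  by_cases h : Function.Bijective S
  · have h' := hbij.2 h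
    rw [resolvent, resolvent, dif_pos h, dif_pos h']
    apply h.1
    rw [← hSS]
    exact ((LinearEquiv.ofBijective S' h').apply_symm_apply x).trans
      ((LinearEquiv.ofBijective S h).apply_symm_apply x).symm
  · have h' := mt hbij.1 h
    rw [resolvent, resolvent, dif_neg h, dif_neg h', LinearMap.zero_apply, LinearMap.zero_apply,
      map_zero]

theorem IsHInfOp.rescale {T : C0Semigroup X} {hT : T.ExpStable} {f : HInfMinus} {ε : ℝ}
    (hε : 0 < ε) (hTε : (T.rescale ε).ExpStable) {C : T.generator.domain →ₗ[ℂ] X}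
    (hC : IsHInfOp hT f C) :
    IsHInfOp hTε (f.shift ε hε.le) (C.comp (T.domainEquiv ε).toLinearMap) where
  bounded := by
    obtain ⟨c, hc⟩ := hC.bounded
    -- From Ax = (A + ε)x - εx; the absolute value is needed as c carries no sign.
    refine ⟨|c| * (1 + ε), fun x => ?_⟩
    refine (hc (T.domainEquiv ε x)).trans ?_
    have h1 : T.generator (T.domainEquiv ε x)
        = (T.rescale ε).generator x - (ε : ℂ) • (x : X) := by
      rw [generator_rescale_apply, add_sub_cancel_right]
    have h2 : ‖(ε : ℂ) • (x : X)‖ = ε * ‖(x : X)‖ := by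
      rw [norm_smul, Complex.norm_real, Real.norm_eq_abs, abs_of_pos hε]
    rw [h1, coe_domainEquiv]
    have h3 := norm_sub_le ((T.rescale ε).generator x) ((ε : ℂ) • (x : X))
    rw [h2] at h3
    rw [mul_assoc]
    refine mul_le_mul (le_abs_self c) ?_ (by positivity) (abs_nonneg c)
    nlinarith [norm_nonneg ((T.rescale ε).generator x)]
  toeplitz_eq y x := by
    -- The rate is that of the rescaled semigroup, so orbits of T decay at rate ω + ε.
    obtain ⟨M, ω, hω, hM⟩ := id hTε
    set x' : T.generator.domain := T.domainEquiv ε x with hx'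
    have hF : ∀ t > 0, ‖y (T t.toNNReal (x' : X))‖
        ≤ ‖y‖ * (M * ‖(x : X)‖) * Real.exp (-(ω + ε) * t) := by
      intro t ht
      have h := norm_orbit_le hM (x : X) y t ht
      rw [rescale_apply, map_smul, norm_smul, Complex.norm_real, Real.norm_eq_abs, Real.abs_exp,
        Real.coe_toNNReal _ ht.le] at h
      have h1 : Real.exp (-(ω + ε) * t) = Real.exp (-ω * t) / Real.exp (ε * t) := by
        rw [← Real.exp_sub]
        ring_nf
      rw [h1, ← mul_div_assoc, le_div_iff₀ (Real.exp_pos _), mul_comm]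
      exact h
    have hae : (fun t : ℝ => y (T.rescale ε t.toNNReal (x : X)))
        =ᵐ[volume.restrict (Ioi 0)]
          fun t => (Real.exp (ε * t) : ℂ) * y (T t.toNNReal (x' : X)) := by
      filter_upwards [ae_restrict_mem measurableSet_Ioi] with t ht
      rw [rescale_apply, map_smul, Real.coe_toNNReal _ (le_of_lt ht)]
      rfl
    have h2' := (memLp_orbit hTε (x : X) y).ae_eq hae
    have horb : orbit hTε (x : X) y = h2'.toLp := MemLp.toLp_congr _ _ hae
    rw [horb]
    have h := toeplitz_shift_ae_eq f (F := fun t => y (T t.toNNReal (x' : X))) hε hω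
      (y.continuous.comp (T.continuous_orbit x')).aestronglyMeasurable hF
      (memLp_orbit hT (x' : X) y) h2'
    filter_upwards [h, hC.toeplitz_eq y x', ae_restrict_mem measurableSet_Ioi] with t h1 h2 ht
    refine h1.trans ((congrArg _ h2).trans ?_)
    have h3 : T.domainEquiv ε ⟨T.rescale ε t.toNNReal x, (T.rescale ε).map_mem_domain _ x.2⟩
        = ((Real.exp (ε * t) : ℝ) : ℂ) •
          (⟨T t.toNNReal x', T.map_mem_domain _ x'.2⟩ : T.generator.domain) := by
      refine Subtype.ext ?_
      rw [coe_domainEquiv, Submodule.coe_smul]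
      simp only [rescale_apply, Real.coe_toNNReal _ (le_of_lt ht)]
      rfl
    rw [LinearMap.comp_apply, LinearEquiv.coe_coe, h3, map_smul, map_smul, smul_eq_mul]

lemma tendsto_smul_shift {u : ℝ → X} {a : ℝ} {z : X}
    (h : Tendsto (fun μ : ℝ => (μ : ℂ) • u μ) atTop (𝓝 z)) :
    Tendsto (fun μ : ℝ => (μ : ℂ) • u (μ - a)) atTop (𝓝 z) := by
  have h1 : Tendsto (fun μ : ℝ => μ - a) atTop atTop := tendsto_atTop_add_const_right _ _ tendsto_id
  -- The scalar equals μ/(μ - a), which converts the weight μ - a into μ.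
  have h2 : Tendsto (fun μ : ℝ => ((1 + a * (μ - a)⁻¹ : ℝ) : ℂ)) atTop (𝓝 1) := by
    have h3 := ((tendsto_inv_atTop_zero.comp h1).const_mul a).const_add 1
    rw [mul_zero, add_zero] at h3
    have h4 := (Complex.continuous_ofReal.tendsto _).comp h3
    rw [Complex.ofReal_one] at h4
    exact h4
  have h5 := h2.smul (h.comp h1)
  rw [one_smul] at h5
  refine h5.congr' ?_
  filter_upwards [eventually_gt_atTop a] with μ hμ
  have hne : μ - a ≠ 0 := (sub_pos.2 hμ).ne'
  rw [Function.comp_apply, smul_smul, ← Complex.ofReal_mul]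
  congr 2
  field_simp
  ring

lemma limitOp_congr {ι D : Type*} [AddCommGroup D] [Module ℂ D] {l : Filter ι} [l.NeBot]
    {F G : ι → D →ₗ[ℂ] X}
    (h : ∀ x z, Tendsto (fun i => F i x) l (𝓝 z) ↔ Tendsto (fun i => G i x) l (𝓝 z)) :
    limitOp l F = limitOp l G := by
  refine LinearPMap.ext (Submodule.ext fun x => exists_congr (h x)) fun x hx hx' => ?_
  exact tendsto_nhds_unique ((h _ _).1 (limitOp_spec l F ⟨x, hx⟩)) (limitOp_spec l G ⟨x, hx'⟩)

theorem lambdaExt_rescale (T : C0Semigroup X) (ε : ℝ) (C : T.generator.domain →ₗ[ℂ] X) :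
    (T.rescale ε).lambdaExt (C.comp (T.domainEquiv ε).toLinearMap) = T.lambdaExt C := by
  refine limitOp_congr fun x z => ?_
  simp only [LinearMap.smul_apply, LinearMap.comp_apply, LinearEquiv.coe_coe, resolvent_rescale]
  simp only [← Complex.ofReal_sub]
  constructor
  · intro h
    have h1 := tendsto_smul_shift (u := fun μ : ℝ => C (T.resolvent ((μ - ε : ℝ) : ℂ) x))
      (a := -ε) h
    simpa using h1
  · intro h
    exact tendsto_smul_shift (u := fun μ : ℝ => C (T.resolvent (μ : ℂ) x)) (a := ε) h

end C0Semigroup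

end HInfCalculus

end

/-! ### Invariance of the calculus under rescaling -/

theorem lemma4p2 {X : Type*} [NormedAddCommGroup X] [NormedSpace ℂ X] [CompleteSpace X]
    (T : HInfCalculus.C0Semigroup X) (hT : T.ExpStable)
    (f : HInfCalculus.HInfMinus) (ε : ℝ) (hε : 0 < ε) (hTε : (T.rescale ε).ExpStable) :
    (T.rescale ε).generator
        = T.generator + ((ε : ℂ) • (LinearMap.id : X →ₗ[ℂ] X)).toPMap ⊤ ∧
      (∃! C, HInfCalculus.C0Semigroup.IsHInfOp hT f C) ∧
      (∃! C, HInfCalculus.C0Semigroup.IsHInfOp hTε (f.shift ε hε.le) C) ∧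
      HInfCalculus.C0Semigroup.lambdaCalc hTε (f.shift ε hε.le)
        = HInfCalculus.C0Semigroup.lambdaCalc hT f := by
  refine ⟨T.generator_rescale ε, HInfCalculus.C0Semigroup.existsUnique_isHInfOp hT f,
    HInfCalculus.C0Semigroup.existsUnique_isHInfOp hTε _, ?_⟩
  have h := (HInfCalculus.C0Semigroup.isHInfOp_hInfOp hT f).rescale hε hTε
  rw [HInfCalculus.C0Semigroup.lambdaCalc, HInfCalculus.C0Semigroup.lambdaCalc,
    (HInfCalculus.C0Semigroup.isHInfOp_hInfOp hTε (f.shift ε hε.le)).eq h,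
    HInfCalculus.C0Semigroup.lambdaExt_rescale]
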